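/- All digraphs are finite, without loops and parallel arcs. For a digraph $H$, the statement $\delta^-(H)\ge 1$ means that every vertex of $H$ has in-degree at least $1$ in $H$ (this holds for the empty digraph). Let $D=(V,A)$ be a digraph with $\delta^-(D)\ge 1$, let $k_1,k_2$ be natural numbers, and let $k=\max\{k_1,k_2\}$. Call an arc $uv\in A$ non-branchable if $D-\{u,v\}$ has no subdigraph $D''$ with at least $k_2$ vertices and $\delta^-(D'')\ge 1$; let $B$ be the set of arcs of $D$ that are not non-branchable, and let $N_B^+(u)=\{v : uv\in B\}$ for $u\in V$. A good 2-partition is a partition $(V_1,V_2)$ of $V$ with $|V_1|\ge k_1$ and $|V_2|\ge k_2$ such that $D[V_1]$ has an out-branching (a spanning out-tree, that is, a spanning connected subdigraph in which one vertex, the root, has in-degree $0$ and every other vertex has in-degree $1$) and $\delta^-(D[V_2])\ge 1$. Then for every vertex $s\in V$ with $|N_B^+(s)|\ge 64k^4+8k^2$ there is a good 2-partition $(V_1,V_2)$ for which the out-branching of $D[V_1]$ can be chosen with root $s$. Moreover, there is an algorithm which, for every input $(D,k_1,k_2)$ as above such that at least one vertex $s$ satisfies $|N_B^+(s)|\ge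 64k^4+8k^2$, finds a good 2-partition in time polynomial in $|V|$; and there is an algorithm which, for every input $(D,k_1,k_2,s)$ as above with $|N_B^+(s)|\ge 64k^4+8k^2$, finds a good 2-partition with root $s$ in time polynomial in $|V|$. -/

import Mathlib

/-! ### Digraphs, out-branchings, good 2-partitions -/

namespace TwoPartition

/-- `D` has no loops. (A `Digraph` has no parallel arcs by construction.) -/
def Loopless {V : Type*} (D : Digraph V) : Prop := ∀ v, ¬ D.Adj v v

/-- The digraph with vertex set `W` and with the arcs of `D` inside `W`, that is `D[W]`, has
minimum in-degree at least one. It holds for `W = ∅`. -/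
def MinInDegreeGeOne {V : Type*} (D : Digraph V) (W : Set V) : Prop :=
  ∀ v ∈ W, ∃ u ∈ W, D.Adj u v

/-- `D - {u, v}` has a subdigraph with at least `m` vertices and minimum in-degree at least one:
the subdigraph has vertex set `W` and the arcs of `H` inside `W`. -/
def HasLargeSubdigraphAvoiding {V : Type*} (D : Digraph V) (m : ℕ) (u v : V) : Prop :=
  ∃ (W : Set V) (H : Digraph V), H ≤ D ∧ u ∉ W ∧ v ∉ W ∧ m ≤ W.ncard ∧ MinInDegreeGeOne H W

/-- The arc `uv` of `D` is non-branchable. -/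
def NonBranchable {V : Type*} (D : Digraph V) (k₂ : ℕ) (u v : V) : Prop :=
  D.Adj u v ∧ ¬ HasLargeSubdigraphAvoiding D k₂ u v

/-- The spanning subdigraph `D_B = (V, B)` of `D`, where `B` is the set of arcs of `D` that are
not non-branchable. -/
def branchableDigraph {V : Type*} (D : Digraph V) (k₂ : ℕ) : Digraph V where
  Adj u v := D.Adj u v ∧ ¬ NonBranchable D k₂ u v

/-- The set `N_B⁺(u)` of out-neighbours of `u` in `D_B`. -/
def branchableOutNeighbors {V : Type*} (D : Digraph V) (k₂ : ℕ) (u : V) : Set V :=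
  {v | (branchableDigraph D k₂).Adj u v}

/-- The digraph with vertex set `W` and with the arcs of `T` is an out-tree rooted in `s`. -/
structure IsOutTree {V : Type*} (T : Digraph V) (W : Set V) (s : V) : Prop where
  root_mem : s ∈ W
  arcs_inside : ∀ u v, T.Adj u v → u ∈ W ∧ v ∈ W
  connected : (T.toSimpleGraphInclusive.induce W).Connected
  root_no_in : ∀ u, ¬ T.Adj u s
  unique_in : ∀ v ∈ W, v ≠ s → ∃! u, T.Adj u v

/-- `D[W]` has an out-branching rooted in `s`. -/
def HasOutBranching {V : Type*} (D : Digraph V) (W : Set V) (s : V) : Prop :=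
  ∃ T : Digraph V, T ≤ D ∧ IsOutTree T W s

/-- `(V₁, V₂)` is a good 2-partition of `D` for the bounds `k₁`, `k₂`, and the out-branching of
`D[V₁]` can be taken with root `s`. -/
structure IsGoodPartitionWithRoot {V : Type*} (D : Digraph V) (k₁ k₂ : ℕ) (s : V)
    (V₁ V₂ : Set V) : Prop where
  disjoint : Disjoint V₁ V₂
  union : V₁ ∪ V₂ = Set.univ
  outBranching : HasOutBranching D V₁ s
  minInDegree : MinInDegreeGeOne D V₂
  card₁ : k₁ ≤ V₁.ncard
  card₂ : k₂ ≤ V₂.ncard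

/-- `s` has at least `64 k ^ 4 + 8 k ^ 2` out-neighbours in `D_B`, where `k = max {k₁, k₂}`. -/
def ManyBranchableOutNeighbors {V : Type*} (D : Digraph V) (k₁ k₂ : ℕ) (s : V) : Prop :=
  64 * (max k₁ k₂) ^ 4 + 8 * (max k₁ k₂) ^ 2 ≤ (branchableOutNeighbors D k₂ s).ncard

/-! ### A random access machine with a step count

Programs work on natural numbers, stored in registers and in two-dimensional arrays. The
arithmetic operations are addition and truncated subtraction only, so that a number computed in
`t` steps has at most linearly in `t` more bits than the inputs and the constants of the program;
hence polynomial time for this machine is polynomial time for Turing machines. -/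

/-- A memory state: `reg x` is the content of register `x`, and `mem a i j` is the entry `(i, j)`
of array `a`. -/
structure Store where
  reg : ℕ → ℕ
  mem : ℕ → ℕ → ℕ → ℕ

/-- Expressions: constants, registers, sums, truncated differences, array entries. -/
inductive Expr where
  | const (c : ℕ)
  | var (x : ℕ)
  | add (e₁ e₂ : Expr)
  | sub (e₁ e₂ : Expr)
  | get (a : ℕ) (e₁ e₂ : Expr)

/-- The value of an expression in a memory state. -/
def Expr.eval (σ : Store) : Expr → ℕ
  | .const c => c
  | .var x => σ.reg x
  | .add e₁ e₂ => e₁.eval σ + e₂.eval σ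
  | .sub e₁ e₂ => e₁.eval σ - e₂.eval σ
  | .get a e₁ e₂ => σ.mem a (e₁.eval σ) (e₂.eval σ)

/-- The number of steps for evaluating an expression: one step for each operation, constant or
register in it. -/
def Expr.cost : Expr → ℕ
  | .const _ => 1
  | .var _ => 1
  | .add e₁ e₂ => e₁.cost + e₂.cost + 1
  | .sub e₁ e₂ => e₁.cost + e₂.cost + 1
  | .get _ e₁ e₂ => e₁.cost + e₂.cost + 1

/-- Programs. -/
inductive Program where
  | skip
  /-- `x := e` -/
  | assign (x : ℕ) (e : Expr)
  /-- `a[e₁, e₂] := e` -/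
  | put (a : ℕ) (e₁ e₂ e : Expr)
  /-- first `P`, then `Q` -/
  | seq (P Q : Program)
  /-- if `e ≠ 0` then `P` else `Q` -/
  | ite (e : Expr) (P Q : Program)
  /-- while `e ≠ 0` do `P` -/
  | loop (e : Expr) (P : Program)

/-- Write `c` into register `x`. -/
def Store.setReg (σ : Store) (x c : ℕ) : Store where
  reg y := if y = x then c else σ.reg y
  mem := σ.mem

/-- Write `c` into the entry `(i, j)` of array `a`. -/
def Store.setMem (σ : Store) (a i j c : ℕ) : Store where
  reg := σ.reg
  mem b p q := if b = a ∧ p = i ∧ q = j then c else σ.mem b p q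

/-- `Exec P σ t τ`: the program `P`, started in the memory state `σ`, halts after exactly `t` steps
in the memory state `τ`. -/
inductive Exec : Program → Store → ℕ → Store → Prop where
  | skip (σ : Store) : Exec .skip σ 1 σ
  | assign (σ : Store) (x : ℕ) (e : Expr) :
      Exec (.assign x e) σ (e.cost + 1) (σ.setReg x (e.eval σ))
  | put (σ : Store) (a : ℕ) (e₁ e₂ e : Expr) :
      Exec (.put a e₁ e₂ e) σ (e₁.cost + e₂.cost + e.cost + 1)
        (σ.setMem a (e₁.eval σ) (e₂.eval σ) (e.eval σ))
  | seq {P Q : Program} {σ₁ σ₂ σ₃ : Store} {t₁ t₂ : ℕ} :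
      Exec P σ₁ t₁ σ₂ → Exec Q σ₂ t₂ σ₃ → Exec (.seq P Q) σ₁ (t₁ + t₂) σ₃
  | iteTrue {e : Expr} {P Q : Program} {σ τ : Store} {t : ℕ} :
      e.eval σ ≠ 0 → Exec P σ t τ → Exec (.ite e P Q) σ (e.cost + 1 + t) τ
  | iteFalse {e : Expr} {P Q : Program} {σ τ : Store} {t : ℕ} :
      e.eval σ = 0 → Exec Q σ t τ → Exec (.ite e P Q) σ (e.cost + 1 + t) τ
  | loopTrue {e : Expr} {P : Program} {σ₁ σ₂ σ₃ : Store} {t₁ t₂ : ℕ} :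
      e.eval σ₁ ≠ 0 → Exec P σ₁ t₁ σ₂ → Exec (.loop e P) σ₂ t₂ σ₃ →
        Exec (.loop e P) σ₁ (e.cost + 1 + t₁ + t₂) σ₃
  | loopFalse {e : Expr} {P : Program} {σ : Store} :
      e.eval σ = 0 → Exec (.loop e P) σ (e.cost + 1) σ

/-- The input `(D, k₁, k₂)`, where `D` has the vertices `0, …, n - 1`: registers `0`, `1`, `2` hold
`n`, `k₁`, `k₂`, array `0` holds the adjacency matrix of `D`, and everything else is `0`. -/
noncomputable def input {n : ℕ} (D : Digraph (Fin n)) (k₁ k₂ : ℕ) : Store where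
  reg x := if x = 0 then n else if x = 1 then k₁ else if x = 2 then k₂ else 0
  mem a i j :=
    open Classical in
    if a = 0 ∧ ∃ u v : Fin n, (u : ℕ) = i ∧ (v : ℕ) = j ∧ D.Adj u v then 1 else 0

/-- The input `(D, k₁, k₂, s)`: as before, and register `3` holds the vertex `s`. -/
noncomputable def inputWithVertex {n : ℕ} (D : Digraph (Fin n)) (k₁ k₂ : ℕ) (s : Fin n) : Store :=
  (input D k₁ k₂).setReg 3 s

/-- The set of vertices that a final memory state describes: column `0` of array `1` holds its
indicator vector. -/
def outputSet (n : ℕ) (τ : Store) : Set (Fin n) := {v | τ.mem 1 v 0 ≠ 0}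

end TwoPartition

/-! Suppose `W` avoids `s`, has minimum in-degree at least one and at least `k₂` vertices, and
leaves at least `k₁` out-neighbours of `s` uncovered. Let `R` be the set reachable from `s` in `D -
W`. A search tree spans `R`, and `R` contains the uncovered out-neighbours. The complement contains
`W`, and a vertex outside `R ∪ W` has an in-neighbour in `D`, which cannot lie in `R`. So `R` and
its complement form a good partition (`isGoodPartitionWithRoot_reachable`, `le_ncard_reachable`).

Such a `W` grows from the empty set (`exists_large_removable`). While it has fewer than `k₂`
vertices, add the head of an arc leaving `W`, other than `s`. If there is no such arc, add a light
set: a nonempty set of minimum in-degree at least one, disjoint from `W ∪ {s}`, that leaves at least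
`k₁ + k₂` out-neighbours of `s` uncovered. The fewer than `k₂` old vertices cover few more.

A light set exists at that point because of `exists_mem_all_of_diff_le`. If every candidate
contained almost all of `N_B⁺(s) \ W`, a count of the layers around a vertex on a cycle would yield
one out-neighbour `x` common to all candidates. But `sx` is branchable, so some large set of minimum
in-degree at least one avoids `s` and `x`; deleting the closed set `W` from it leaves a candidate
without `x`.

The same growth is an algorithm. A light set exists exactly when some closed walk has small total
weight, which a shortest-walk computation detects; an inclusion-minimal vertex set still containing
a light set is itself light. The branchable arcs are never computed: for an unknown root, all roots
are tried and the sizes of the two parts are checked. -/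

namespace TwoPartition

/-! ### Light sets, and a vertex common to all sets of minimum in-degree at least one -/

section Combinatorics

variable {V : Type*}

/-- There is a set `S ⊆ G` of weight at most `w` (the number of its elements in `X`) that contains
`j` and in which every vertex has an in-neighbour in `S ∪ {i}`. -/
def Linked (D : Digraph V) (G X : Set V) (i : V) (w : ℕ) (j : V) : Prop :=
  ∃ S ⊆ G, j ∈ S ∧ (∀ v ∈ S, ∃ u, (u ∈ S ∨ u = i) ∧ D.Adj u v) ∧ (S ∩ X).ncard ≤ w

/-- `G` contains a nonempty set of minimum in-degree at least one and of weight at most `w`. -/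
def HasLightSet (D : Digraph V) (G X : Set V) (w : ℕ) : Prop :=
  ∃ S ⊆ G, S.Nonempty ∧ MinInDegreeGeOne D S ∧ (S ∩ X).ncard ≤ w

theorem HasLightSet.mono {D : Digraph V} {G G' X : Set V} {w : ℕ} (h : HasLightSet D G X w)
    (hG : G ⊆ G') : HasLightSet D G' X w := by
  obtain ⟨S, hS, h⟩ := h
  exact ⟨S, hS.trans hG, h⟩

theorem MinInDegreeGeOne.union {D : Digraph V} {S T : Set V} (hS : MinInDegreeGeOne D S)
    (hT : MinInDegreeGeOne D T) : MinInDegreeGeOne D (S ∪ T) := by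
  rintro v (hv | hv)
  · obtain ⟨u, hu, h⟩ := hS v hv
    exact ⟨u, Or.inl hu, h⟩
  · obtain ⟨u, hu, h⟩ := hT v hv
    exact ⟨u, Or.inr hu, h⟩

theorem MinInDegreeGeOne.insert {D : Digraph V} {S : Set V} (hS : MinInDegreeGeOne D S) {u v : V}
    (hu : u ∈ S) (h : D.Adj u v) : MinInDegreeGeOne D (insert v S) := by
  rintro x (rfl | hx)
  · exact ⟨u, Or.inr hu, h⟩
  · obtain ⟨y, hy, h⟩ := hS x hx
    exact ⟨y, Or.inr hy, h⟩

theorem Linked.of_adj {D : Digraph V} {G X : Set V} {i j : V} (hj : j ∈ G) (h : D.Adj i j) :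
    Linked D G X i ((({j} : Set V) ∩ X).ncard) j :=
  ⟨{j}, by simpa using hj, rfl, by rintro v rfl; exact ⟨i, Or.inr rfl, h⟩, le_rfl⟩

theorem Linked.trans {D : Digraph V} {G X : Set V} {i j l : V} {a b : ℕ}
    (h₁ : Linked D G X i a j) (h₂ : Linked D G X j b l) : Linked D G X i (a + b) l := by
  obtain ⟨S, hS, hjS, hS', hSa⟩ := h₁
  obtain ⟨T, hT, hlT, hT', hTb⟩ := h₂
  refine ⟨S ∪ T, Set.union_subset hS hT, Or.inr hlT, ?_, ?_⟩
  · rintro v (hv | hv)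
    · obtain ⟨u, hu, h⟩ := hS' v hv
      exact ⟨u, hu.imp Or.inl id, h⟩
    · obtain ⟨u, hu | rfl, h⟩ := hT' v hv
      · exact ⟨u, Or.inl (Or.inr hu), h⟩
      · exact ⟨u, Or.inl (Or.inl hjS), h⟩
  · rw [Set.union_inter_distrib_right]
    exact (Set.ncard_union_le _ _).trans (by omega)

theorem Linked.mono {D : Digraph V} {G X : Set V} {i j : V} {a b : ℕ}
    (h : Linked D G X i a j) (hab : a ≤ b) : Linked D G X i b j := by
  obtain ⟨S, hS, hjS, hS', hSa⟩ := h
  exact ⟨S, hS, hjS, hS', hSa.trans hab⟩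

/-- When the outside vertex `i` itself lies in `S`, it no longer counts as outside. This turns
closed walks into light sets. -/
theorem Linked.hasLightSet {D : Digraph V} {G X : Set V} {i : V} {a : ℕ}
    (h : Linked D G X i a i) : HasLightSet D G X a := by
  obtain ⟨S, hS, hi, hS', ha⟩ := h
  refine ⟨S, hS, ⟨i, hi⟩, fun v hv => ?_, ha⟩
  obtain ⟨u, hu | rfl, h⟩ := hS' v hv
  · exact ⟨u, hu, h⟩
  · exact ⟨u, hi, h⟩

/-- A set of minimum in-degree at least one contains a cycle, listed here backwards as the orbit of
a periodic point of a predecessor function. -/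
theorem MinInDegreeGeOne.exists_cycle [Finite V] {D : Digraph V} {S : Set V}
    (hS : MinInDegreeGeOne D S) (hne : S.Nonempty) : ∃ (c : ℕ → V) (p : ℕ), 0 < p ∧ p ≤ Nat.card V ∧ c p = c 0 ∧
      (∀ t, c t ∈ S ∧ D.Adj (c (t + 1)) (c t)) ∧ Set.InjOn c (Set.Iio p) := by
  choose! f hfS hf using hS
  obtain ⟨x, hx⟩ := hne
  have hmem : ∀ t, f^[t] x ∈ S := fun t => by
    induction t with
    | zero => exact hx
    | succ t ih => rw [Function.iterate_succ_apply']; exact hfS _ ih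
  obtain ⟨a, b, hab, he⟩ : ∃ a b, a < b ∧ f^[a] x = f^[b] x := by
    obtain ⟨a, b, hab, he⟩ := Finite.exists_ne_map_eq_of_infinite (fun t => f^[t] x)
    rcases lt_or_gt_of_ne hab with h | h
    · exact ⟨a, b, h, he⟩
    · exact ⟨b, a, h, he.symm⟩
  set y := f^[a] x with hy
  have hper : y ∈ Function.periodicPts f := by
    refine Function.mk_mem_periodicPts (n := b - a) (by omega) ?_
    change f^[b - a] (f^[a] x) = f^[a] x
    rw [← Function.iterate_add_apply, Nat.sub_add_cancel hab.le]
    exact he.symm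
  have hyS : ∀ t, f^[t] y ∈ S := fun t => by
    rw [hy, ← Function.iterate_add_apply]; exact hmem _
  have hinj : Set.InjOn (fun t => f^[t] y) (Set.Iio (Function.minimalPeriod f y)) :=
    Function.iterate_injOn_Iio_minimalPeriod
  refine ⟨fun t => f^[t] y, Function.minimalPeriod f y,
    Function.minimalPeriod_pos_of_mem_periodicPts hper, ?_, ?_, fun t => ⟨hyS t, ?_⟩, hinj⟩
  · have := hinj.ncard_image
    rw [show (Set.Iio (Function.minimalPeriod f y)).ncard = Function.minimalPeriod f y by
      rw [Set.ncard_eq_toFinset_card']; simp] at this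
    rw [← this, ← Set.ncard_univ]
    exact Set.ncard_le_ncard (Set.subset_univ _)
  · exact Function.isPeriodicPt_minimalPeriod f y
  · change D.Adj (f^[t + 1] y) _
    rw [Function.iterate_succ_apply']
    exact hf _ (hyS t)

/-- If every set of minimum in-degree at least one contains all but at most `q` elements of a large
set `X`, then some element of `X` lies in all of these sets. -/
theorem exists_mem_all_of_diff_le [Finite V] {D : Digraph V} {G X : Set V} {q : ℕ}
    (hq : ∀ S ⊆ G, S.Nonempty → MinInDegreeGeOne D S → (X \ S).ncard ≤ q)
    (hX : 4 * q + 10 ≤ X.ncard) :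
    ∃ x ∈ X, ∀ S ⊆ G, S.Nonempty → MinInDegreeGeOne D S → x ∈ S := by
  by_contra! hcon
  obtain ⟨x₀, hx₀⟩ : X.Nonempty := Set.nonempty_of_ncard_ne_zero (by omega)
  obtain ⟨S₀, hS₀G, hS₀, hS₀', -⟩ := hcon x₀ hx₀
  obtain ⟨c, p, hp, -, hcp, hc, -⟩ := hS₀'.exists_cycle hS₀
  -- The sets `A j` below play the role of balls of radius `j` around `r`, where only vertices of
  -- `X` have length. Since `r` lies on a cycle inside `G`, a ball that stops growing contains an
  -- in-neighbour of `r`.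
  set r := c 0 with hr
  let A : ℕ → Set V := fun j => {v | v = r ∨ Linked D G X r j v}
  have hrA : ∀ j, r ∈ A j := fun j => Or.inl rfl
  have hAmono : ∀ j, A j ⊆ A (j + 1) := fun j v hv => hv.imp id fun h => h.mono (by omega)
  have hstep : ∀ j u v, u ∈ A j → v ∈ G → D.Adj u v → v ∈ A (j + (({v} : Set V) ∩ X).ncard) := by
    rintro j u v (rfl | hu) hv h
    · exact Or.inr ((Linked.of_adj hv h).mono (by omega))
    · exact Or.inr (hu.trans (Linked.of_adj hv h))
  have hle1 : ∀ v : V, (({v} : Set V) ∩ X).ncard ≤ 1 := fun v =>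
    (Set.ncard_le_ncard Set.inter_subset_left).trans (by simp)
  have hstepX : ∀ j u v, u ∈ A j → v ∈ G → D.Adj u v → v ∈ A (j + 1) := by
    intro j u v hu hv h
    have h1 := hstep j u v hu hv h
    have h2 := hle1 v
    interval_cases hh : (({v} : Set V) ∩ X).ncard
    · exact hAmono _ h1
    · exact h1
  have hstep0 : ∀ j u v, u ∈ A j → v ∈ G → v ∉ X → D.Adj u v → v ∈ A j := by
    intro j u v hu hv hvX h
    have h1 := hstep j u v hu hv h
    rwa [show ({v} : Set V) ∩ X = ∅ by simpa using hvX, Set.ncard_empty] at h1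
  let a : ℕ → ℕ := fun j => (X ∩ A j).ncard
  have haX : ∀ j, a j + (X \ A j).ncard = X.ncard := fun j =>
    Set.ncard_inter_add_ncard_sdiff_eq_ncard X (A j)
  -- the levels below the length of a shortest cycle are nonempty
  have hgrow : ∀ j, j + q + 1 < X.ncard → a j + 1 ≤ a (j + 1) := by
    intro j hj
    by_contra! hlt
    have heq : X ∩ A j = X ∩ A (j + 1) :=
      Set.eq_of_subset_of_ncard_le (Set.inter_subset_inter_right _ (hAmono j)) (by
        change a (j + 1) ≤ a j; omega)
    have hclosed : ∀ u v, u ∈ A j → v ∈ G → D.Adj u v → v ∈ A j := by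
      intro u v hu hv h
      by_cases hvX : v ∈ X
      · exact (heq.symm ▸ (⟨hvX, hstepX j u v hu hv h⟩ : v ∈ X ∩ A (j + 1)) : v ∈ X ∩ A j).2
      · exact hstep0 j u v hu hv hvX h
    -- The cycle is indexed against its arcs, so decreasing the index from `c p = r` follows arcs
    -- forwards and stays in the closed set.
    have hall : ∀ t ≤ p, c (p - t) ∈ A j := by
      intro t
      induction t with
      | zero => intro _; rw [Nat.sub_zero, hcp]; exact hrA j
      | succ t ih =>
        intro ht
        refine hclosed _ _ (ih (by omega)) (hS₀G (hc _).1) ?_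
        have := (hc (p - (t + 1))).2
        rwa [show p - (t + 1) + 1 = p - t by omega] at this
    have h1 : c 1 ∈ A j := by
      have := hall (p - 1) (by omega)
      rwa [show p - (p - 1) = 1 by omega] at this
    have hl : Linked D G X r (j + 1) r := by
      have hadj : D.Adj (c 1) r := (hc 0).2
      have hrG : r ∈ G := hS₀G (hc 0).1
      rcases h1 with h1 | h1
      · rw [h1] at hadj
        exact (Linked.of_adj hrG hadj).mono ((hle1 r).trans (by omega))
      · exact (h1.trans (Linked.of_adj hrG hadj)).mono (by have := hle1 r; omega)
    -- This set has at most `j + 1` elements in `X` and misses at most `q`, against `j + q + 1 <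
    -- X.ncard`.
    obtain ⟨S, hSG, hSne, hS, hSc⟩ := hl.hasLightSet
    have h2 := hq S hSG hSne hS
    have h3 := Set.ncard_inter_add_ncard_sdiff_eq_ncard X S
    rw [Set.inter_comm] at h3
    omega
  have hgrow' : ∀ d j, j + d + q < X.ncard → a j + d ≤ a (j + d) := by
    intro d
    induction d with
    | zero => intro j _; exact le_rfl
    | succ d ih =>
      intro j hj
      have h1 := ih j (by omega)
      have h2 := hgrow (j + d) (by omega)
      change a (j + d + 1) ≥ _
      omega
  -- some level has at most one element
  obtain ⟨j, hj1, hj2, hj3⟩ : ∃ j, q + 1 ≤ j ∧ j < 2 * q + 3 ∧ a (j + 1) ≤ a j + 1 := by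
    by_contra! hbig
    have h2 : ∀ d ≤ q + 2, a (q + 1) + 2 * d ≤ a (q + 1 + d) := by
      intro d
      induction d with
      | zero => intro _; exact le_rfl
      | succ d ih =>
        intro hd
        have h1 := ih (by omega)
        have h2 := hbig (q + 1 + d) (by omega) (by omega)
        rw [← add_assoc]; omega
    -- If `q + 2` consecutive layers had two elements each, then `q + 1` elements before them and
    -- `X.ncard - 3 * q - 4` after them would give `X.ncard + 1` elements of `X`.
    have h3 := h2 (q + 2) le_rfl
    have h4 := hgrow' (q + 1) 0 (by omega)
    have h5 := hgrow' (X.ncard - 3 * q - 4) (q + 1 + (q + 2)) (by omega)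
    have h6 := haX (q + 1 + (q + 2) + (X.ncard - 3 * q - 4))
    rw [zero_add] at h4
    omega
  have hlow : q < a j := by
    have := hgrow' j 0 (by omega)
    rw [zero_add] at this
    omega
  have hhigh : q < (X \ A j).ncard := by
    have h1 := hgrow' (q + 1) j (by omega)
    have h2 := haX j
    have h3 := haX (j + (q + 1))
    omega
  obtain ⟨x, hx, hlayer⟩ : ∃ x ∈ X, ∀ v ∈ X, v ∈ A (j + 1) → v ∉ A j → v = x := by
    have hd : ((X ∩ A (j + 1)) \ (X ∩ A j)).ncard ≤ 1 := by
      have := Set.ncard_sdiff_add_ncard_of_subset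
        (Set.inter_subset_inter_right X (hAmono j))
      change _ + a j = a (j + 1) at this
      omega
    rcases Set.eq_empty_or_nonempty ((X ∩ A (j + 1)) \ (X ∩ A j)) with h | ⟨x, hx⟩
    -- An empty layer imposes nothing, so any element of `X` serves.
    · refine ⟨x₀, hx₀, fun v hv h1 h2 => ?_⟩
      have : v ∈ (X ∩ A (j + 1)) \ (X ∩ A j) := ⟨⟨hv, h1⟩, fun h => h2 h.2⟩
      rw [h] at this
      exact this.elim
    · exact ⟨x, hx.1.1, fun v hv h1 h2 =>
        Set.ncard_le_one (Set.toFinite _) |>.1 hd v ⟨⟨hv, h1⟩, fun h => h2 h.2⟩ x hx⟩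
  obtain ⟨S, hSG, hSne, hS, hxS⟩ := hcon x hx
  -- `S` avoids `x`, the only vertex through which an arc of `G` can leave `A j`. Hence `S \ A j`
  -- keeps its in-neighbours, although it misses the more than `q` elements of `X ∩ A j`. It is
  -- nonempty because `S ⊆ A j` would miss the more than `q` elements of `X \ A j`.
  have hdiff : (S \ A j).Nonempty := by
    by_contra hemp
    rw [Set.not_nonempty_iff_eq_empty, Set.sdiff_eq_empty] at hemp
    have := Set.ncard_le_ncard (Set.sdiff_subset_sdiff_right (s := X) hemp)
    have := hq S hSG hSne hS
    omega
  have hnot : ¬ MinInDegreeGeOne D (S \ A j) := by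
    intro h
    have h1 := hq _ (Set.sdiff_subset.trans hSG) hdiff h
    have h2 : a j ≤ (X \ (S \ A j)).ncard :=
      Set.ncard_le_ncard fun v hv => ⟨hv.1, fun h => h.2 hv.2⟩
    omega
  apply hnot
  intro v hv
  obtain ⟨u, hu, huv⟩ := hS v hv.1
  refine ⟨u, ⟨hu, fun huA => ?_⟩, huv⟩
  by_cases hvX : v ∈ X
  · exact hxS (hlayer v hvX (hstepX j u v huA (hSG hv.1) huv) hv.2 ▸ hv.1)
  · exact hv.2 (hstep0 j u v huA (hSG hv.1) hvX huv)

/-! ### Light sets next to a closed set -/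

/-- The set of out-neighbours of `s`. -/
def outNeighbors (D : Digraph V) (s : V) : Set V := {v | D.Adj s v}

/-- The bound on the number of out-neighbours of `s` on a cycle. -/
noncomputable def lightBound (D : Digraph V) (k₁ k₂ : ℕ) (s : V) : ℕ :=
  (outNeighbors D s).ncard - k₁ - k₂

/-- Only this linear consequence of the degree bound is needed: it covers `4 * q + 10` with `q = k₁
+ k₂`, plus the fewer than `k₂` vertices lost to `W`. Without `0 < k₂` it fails for `k₁ = k₂ = 0`.
-/
theorem ManyBranchableOutNeighbors.le_ncard [Finite V] {D : Digraph V} {k₁ k₂ : ℕ} {s : V}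
    (h : ManyBranchableOutNeighbors D k₁ k₂ s) (hk : 0 < k₂) :
    10 * (k₁ + k₂) + k₂ + 10 ≤ (branchableOutNeighbors D k₂ s).ncard := by
  refine le_trans ?_ h
  have h1 : k₁ ≤ max k₁ k₂ := le_max_left _ _
  have h2 : k₂ ≤ max k₁ k₂ := le_max_right _ _
  generalize max k₁ k₂ = k at *
  have h4 : k ≤ k ^ 4 := Nat.le_self_pow (by norm_num) k
  have h5 : k ≤ k ^ 2 := Nat.le_self_pow (by norm_num) k
  omega

theorem branchableOutNeighbors_subset (D : Digraph V) (k₂ : ℕ) (s : V) :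
    branchableOutNeighbors D k₂ s ⊆ outNeighbors D s := fun _ h => h.1

/-- Without a light set, every candidate misses at most `k₁ + k₂` out-neighbours of `s`, so some
branchable out-neighbour `x` lies in all candidates. The set that witnesses branchability of `sx`
contradicts this once `W` is deleted from it. -/
theorem hasLightSet_of_closed [Finite V] {D : Digraph V} {k₁ k₂ : ℕ} {s : V}
    (h : ManyBranchableOutNeighbors D k₁ k₂ s) {W : Set V} (hW : W.ncard < k₂)
    (hclosed : ∀ u ∈ W, ∀ v, D.Adj u v → v ∉ W → v = s) :
    HasLightSet D (insert s W)ᶜ (outNeighbors D s) (lightBound D k₁ k₂ s) := by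
  by_contra hcon
  have hcard := h.le_ncard (by omega)
  have hsub := Set.ncard_le_ncard (branchableOutNeighbors_subset D k₂ s)
  obtain ⟨x, hx, hall⟩ := exists_mem_all_of_diff_le (D := D) (G := (insert s W)ᶜ)
    (X := branchableOutNeighbors D k₂ s \ W) (q := k₁ + k₂) (by
      intro S hSG hSne hS
      have h1 : lightBound D k₁ k₂ s < (S ∩ outNeighbors D s).ncard := by
        by_contra! hle
        exact hcon ⟨S, hSG, hSne, hS, hle⟩
      have h2 := Set.ncard_inter_add_ncard_sdiff_eq_ncard (outNeighbors D s) S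
      rw [Set.inter_comm] at h2
      have h3 : ((branchableOutNeighbors D k₂ s \ W) \ S).ncard ≤ (outNeighbors D s \ S).ncard :=
        Set.ncard_le_ncard fun v hv => ⟨branchableOutNeighbors_subset D k₂ s hv.1.1, hv.2⟩
      unfold lightBound at h1
      omega) (by
      have := Set.ncard_le_ncard_sdiff_add_ncard (branchableOutNeighbors D k₂ s) W
      omega)
  obtain ⟨W', H, hH, hsW', hxW', hW'c, hW'⟩ : HasLargeSubdigraphAvoiding D k₂ s x := by
    by_contra hno
    exact hx.1.2 ⟨hx.1.1, hno⟩
  -- `W' \ W` is nonempty because `W` is too small to contain `W'`. It keeps its in-neighbours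
  -- because arcs leaving `W` end only in `s`, which is not in `W'`.
  refine hxW' (hall (W' \ W) ?_ ?_ ?_).1
  · rintro v hv (rfl | hvW)
    · exact hsW' hv.1
    · exact hv.2 hvW
  · by_contra hemp
    rw [Set.not_nonempty_iff_eq_empty, Set.sdiff_eq_empty] at hemp
    have := Set.ncard_le_ncard hemp
    omega
  · intro v hv
    obtain ⟨u, hu, huv⟩ := hW' v hv.1
    refine ⟨u, ⟨hu, fun huW => hsW' ?_⟩, hH huv⟩
    exact hclosed u huW v (hH huv) hv.2 ▸ hv.1

/-! ### From a removable set to a good partition -/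

/-- The set of vertices reachable from `s` in `D - W`, where `s` itself counts as reachable. -/
def reachable (D : Digraph V) (W : Set V) (s : V) : Set V :=
  {v | Relation.ReflTransGen (fun u v => D.Adj u v ∧ v ∉ W) s v}

/-- A breadth-first tree: `L n` holds the ends of walks of length `n`, `d` is the distance from `s`,
and `f` chooses a parent at smaller distance. Connectedness follows by induction on `d`. -/
theorem hasOutBranching_reachable (D : Digraph V) (W : Set V) (s : V) :
    HasOutBranching D (reachable D W s) s := by
  let r : V → V → Prop := fun u v => D.Adj u v ∧ v ∉ W
  let L : ℕ → Set V := fun n => Nat.rec {s} (fun _ A => {v | ∃ u ∈ A, r u v}) n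
  have hLR : ∀ n, L n ⊆ reachable D W s := by
    intro n
    induction n with
    | zero =>
      intro v hv
      rw [show v = s from hv]
      exact Relation.ReflTransGen.refl
    | succ n ih =>
      rintro v ⟨u, hu, h⟩
      exact (ih hu).tail h
  have hRL : ∀ v ∈ reachable D W s, ∃ n, v ∈ L n := by
    intro v hv
    replace hv : Relation.ReflTransGen r s v := hv
    induction hv with
    | refl => exact ⟨0, rfl⟩
    | tail _ h ih =>
      obtain ⟨n, hn⟩ := ih
      exact ⟨n + 1, _, hn, h⟩
  have hmin : ∀ v ∈ reachable D W s, ∃ n, v ∈ L n ∧ ∀ m, v ∈ L m → n ≤ m := fun v hv =>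
    ⟨sInf {n | v ∈ L n}, Nat.sInf_mem (hRL v hv), fun m hm => Nat.sInf_le hm⟩
  choose! d hd using hmin
  have hpar : ∀ v ∈ reachable D W s, v ≠ s →
      ∃ u, u ∈ reachable D W s ∧ D.Adj u v ∧ d u < d v := by
    intro v hv hvs
    obtain ⟨h1, h2⟩ := hd v hv
    rcases hn : d v with _ | m
    · rw [hn] at h1
      exact (hvs h1).elim
    · rw [hn] at h1
      obtain ⟨u, hu, h⟩ := h1
      exact ⟨u, hLR m hu, h.1, Nat.lt_succ_of_le ((hd u (hLR m hu)).2 m hu)⟩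
  choose! f hfR hf hfd using hpar
  refine ⟨⟨fun u v => v ∈ reachable D W s ∧ v ≠ s ∧ u = f v⟩, ?_, ?_⟩
  · rintro u v ⟨hv, hvs, rfl⟩
    exact hf v hv hvs
  · have hs : s ∈ reachable D W s := Relation.ReflTransGen.refl
    refine ⟨hs, ?_, ?_, ?_, ?_⟩
    · rintro u v ⟨hv, hvs, rfl⟩
      exact ⟨hfR v hv hvs, hv⟩
    · rw [SimpleGraph.connected_iff_exists_forall_reachable]
      refine ⟨⟨s, hs⟩, ?_⟩
      have key : ∀ m, ∀ v : reachable D W s, d v < m → SimpleGraph.Reachable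
          ((Digraph.toSimpleGraphInclusive ⟨fun u v => v ∈ reachable D W s ∧ v ≠ s ∧ u = f v⟩).induce
            (reachable D W s)) ⟨s, hs⟩ v := by
        intro m
        induction m with
        | zero => intro v hv; omega
        | succ m ih =>
          rintro ⟨v, hv⟩ hm
          by_cases hvs : v = s
          · subst hvs; rfl
          · have hlt := hfd v hv hvs
            refine (ih ⟨f v, hfR v hv hvs⟩ (by simp only at hm ⊢; omega)).trans ?_
            refine SimpleGraph.Adj.reachable ?_
            change f v ≠ v ∧ _
            refine ⟨fun h => ?_, Or.inl ⟨hv, hvs, rfl⟩⟩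
            rw [h] at hlt
            omega
      exact fun v => key _ v (Nat.lt_succ_self _)
    · rintro u ⟨-, h, -⟩
      exact h rfl
    · exact fun v hv hvs => ⟨f v, ⟨hv, hvs, rfl⟩, fun u hu => hu.2.2⟩

/-- A vertex outside both `W` and the reachable set has no reachable in-neighbour, and no vertex of
`W` is reachable. The sizes are hypotheses, so the algorithm can also apply this to roots whose
degree condition is unknown. -/
theorem isGoodPartitionWithRoot_reachable {D : Digraph V} {k₁ k₂ : ℕ} {s : V} {W : Set V}
    (hD : MinInDegreeGeOne D Set.univ) (hsW : s ∉ W) (hW : MinInDegreeGeOne D W)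
    (h₁ : k₁ ≤ (reachable D W s).ncard) (h₂ : k₂ ≤ (reachable D W s)ᶜ.ncard) :
    IsGoodPartitionWithRoot D k₁ k₂ s (reachable D W s) (reachable D W s)ᶜ where
  disjoint := disjoint_compl_right
  union := Set.union_compl_self _
  outBranching := hasOutBranching_reachable D W s
  minInDegree := by
    have hRW : ∀ v ∈ reachable D W s, v ∉ W := by
      intro v hv
      induction hv with
      | refl => exact hsW
      | tail _ h _ => exact h.2
    intro v hv
    by_cases hvW : v ∈ W
    · obtain ⟨u, hu, huv⟩ := hW v hvW
      exact ⟨u, fun h => hRW u h hu, huv⟩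
    · obtain ⟨u, -, huv⟩ := hD v trivial
      exact ⟨u, fun h => hv (Relation.ReflTransGen.tail h ⟨huv, hvW⟩), huv⟩
  card₁ := h₁
  card₂ := h₂

/-- A set of minimum in-degree at least one that can be removed from `D`. -/
def Removable (D : Digraph V) (s : V) (W : Set V) : Prop := s ∉ W ∧ MinInDegreeGeOne D W

/-- `W` contains few out-neighbours of `s`: at most `k₂ - 1` more than a light cycle may have. -/
def IsLight (D : Digraph V) (k₁ k₂ : ℕ) (s : V) (W : Set V) : Prop :=
  (W ∩ outNeighbors D s).ncard ≤ k₂ - 1 + lightBound D k₁ k₂ s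

theorem le_ncard_reachable [Finite V] {D : Digraph V} {k₁ k₂ : ℕ} {s : V} {W : Set V}
    (h : ManyBranchableOutNeighbors D k₁ k₂ s) (hsW : s ∉ W) (hlight : IsLight D k₁ k₂ s W)
    (hW : k₂ ≤ W.ncard) :
    k₁ ≤ (reachable D W s).ncard ∧ k₂ ≤ (reachable D W s)ᶜ.ncard := by
  have hRW : ∀ v ∈ reachable D W s, v ∉ W := by
    intro v hv
    induction hv with
    | refl => exact hsW
    | tail _ h _ => exact h.2
  refine ⟨?_, hW.trans (Set.ncard_le_ncard fun v hv hR => hRW v hR hv)⟩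
  have h1 : outNeighbors D s \ W ⊆ reachable D W s := fun v hv =>
    Relation.ReflTransGen.single hv
  have h2 := Set.ncard_le_ncard h1
  have h3 := Set.ncard_inter_add_ncard_sdiff_eq_ncard (outNeighbors D s) W
  rw [Set.inter_comm] at h3
  have h4 := Set.ncard_le_ncard (branchableOutNeighbors_subset D k₂ s)
  unfold IsLight lightBound at hlight
  -- For `k₂ = 0` the term `k₂ - 1` truncates and `le_ncard` is unavailable; there, having at least
  -- `k₁` out-neighbours is enough.
  rcases Nat.eq_zero_or_pos k₂ with hk | hk
  · have h5 : k₁ ≤ (outNeighbors D s).ncard := by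
      refine le_trans ?_ (le_trans h h4)
      rw [hk, max_eq_left (Nat.zero_le _)]
      have : k₁ ≤ k₁ ^ 4 := Nat.le_self_pow (by norm_num) k₁
      omega
    omega
  · have := h.le_ncard hk
    omega

theorem isLight_insert [Finite V] {D : Digraph V} {k₁ k₂ : ℕ} {s v : V} {W : Set V}
    (h : ManyBranchableOutNeighbors D k₁ k₂ s) (hW : W.ncard < k₂) :
    IsLight D k₁ k₂ s (insert v W) := by
  have h1 := h.le_ncard (by omega)
  have h2 := Set.ncard_le_ncard (branchableOutNeighbors_subset D k₂ s)
  have h3 : (insert v W ∩ outNeighbors D s).ncard ≤ (insert v W).ncard :=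
    Set.ncard_le_ncard Set.inter_subset_left
  have h4 := Set.ncard_insert_le v W
  unfold IsLight lightBound
  omega

/-- The summand `k₂ - 1` in `IsLight` is made for this step: lightness of the old `W` is not used,
only its size. -/
theorem isLight_union [Finite V] {D : Digraph V} {k₁ k₂ : ℕ} {s : V} {W S : Set V}
    (hW : W.ncard < k₂) (hS : (S ∩ outNeighbors D s).ncard ≤ lightBound D k₁ k₂ s) :
    IsLight D k₁ k₂ s (W ∪ S) := by
  have h3 : (W ∩ outNeighbors D s).ncard ≤ W.ncard := Set.ncard_le_ncard Set.inter_subset_left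
  unfold IsLight
  rw [Set.union_inter_distrib_right]
  exact (Set.ncard_union_le _ _).trans (by omega)

theorem exists_large_removable [Finite V] {D : Digraph V} {k₁ k₂ : ℕ} {s : V}
    (h : ManyBranchableOutNeighbors D k₁ k₂ s) :
    ∃ W, Removable D s W ∧ IsLight D k₁ k₂ s W ∧ k₂ ≤ W.ncard := by
  suffices ∀ y, ∃ W, Removable D s W ∧ IsLight D k₁ k₂ s W ∧ min y k₂ ≤ W.ncard by
    obtain ⟨W, h1, h2, h3⟩ := this k₂
    exact ⟨W, h1, h2, by simpa using h3⟩
  intro y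
  induction y with
  | zero => exact ⟨∅, ⟨id, fun v hv => hv.elim⟩, by simp [IsLight], by simp⟩
  | succ y ih =>
    obtain ⟨W, hrem, hlight, hy⟩ := ih
    by_cases hW : k₂ ≤ W.ncard
    · exact ⟨W, hrem, hlight, by omega⟩
    push Not at hW
    by_cases hclosed : ∀ u ∈ W, ∀ v, D.Adj u v → v ∉ W → v = s
    · obtain ⟨S, hSG, ⟨x, hx⟩, hS, hSc⟩ := hasLightSet_of_closed h hW hclosed
      refine ⟨W ∪ S, ⟨?_, hrem.2.union hS⟩, isLight_union hW hSc, ?_⟩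
      · rintro (hs | hs)
        · exact hrem.1 hs
        · exact hSG hs (Or.inl rfl)
      · have : (insert x W).ncard ≤ (W ∪ S).ncard :=
          Set.ncard_le_ncard (Set.insert_subset (Or.inr hx) Set.subset_union_left)
        rw [Set.ncard_insert_of_notMem fun hxW => hSG hx (Or.inr hxW)] at this
        omega
    · push Not at hclosed
      obtain ⟨u, hu, v, huv, hv, hvs⟩ := hclosed
      refine ⟨insert v W, ⟨?_, hrem.2.insert hu huv⟩, isLight_insert h hW, ?_⟩
      · rintro (hs | hs)
        · exact hvs hs.symm
        · exact hrem.1 hs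
      · rw [Set.ncard_insert_of_notMem hv]
        omega

end Combinatorics

end TwoPartition

namespace TwoPartition

/-! ### A language of bounded loops with polynomial running time -/

section Language

@[simp] theorem Store.setReg_mem (σ : Store) (x c : ℕ) : (σ.setReg x c).mem = σ.mem := rfl

@[simp] theorem Store.setMem_reg (σ : Store) (a i j c : ℕ) : (σ.setMem a i j c).reg = σ.reg := rfl

theorem Store.setMem_mem (σ : Store) (a i j c p q : ℕ) :
    (σ.setMem a i j c).mem a p q = if p = i ∧ q = j then c else σ.mem a p q := by
  simp [Store.setMem]

@[simp] theorem Store.setMem_mem_of_ne (σ : Store) {a b : ℕ} (i j c : ℕ) (h : b ≠ a) :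
    (σ.setMem a i j c).mem b = σ.mem b := by
  simp [Store.setMem, h]

/-- Programs all of whose loops run over `x = 0, …, n - 1`, where `n` is the content of
register `0`. -/
inductive LoopProgram where
  | skip
  | assign (x : ℕ) (e : Expr)
  | put (a : ℕ) (e₁ e₂ e : Expr)
  | seq (P Q : LoopProgram)
  | ite (e : Expr) (P Q : LoopProgram)
  | forLoop (x : ℕ) (P : LoopProgram)

namespace LoopProgram

/-- The translation into a `Program`. -/
def compile : LoopProgram → Program
  | skip => .skip
  | assign x e => .assign x e
  | put a e₁ e₂ e => .put a e₁ e₂ e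
  | seq P Q => .seq P.compile Q.compile
  | ite e P Q => .ite e P.compile Q.compile
  | forLoop x P => .seq (.assign x (.const 0))
      (.loop (.sub (.var 0) (.var x)) (.seq P.compile (.assign x (.add (.var x) (.const 1)))))

/-- The final memory state of a loop after `m` iterations of `f`. -/
def iter (x : ℕ) (f : Store → Store) (σ : Store) : ℕ → Store
  | 0 => σ.setReg x 0
  | m + 1 => (f (iter x f σ m)).setReg x (m + 1)

/-- The final memory state. -/
def run : LoopProgram → Store → Store
  | skip, σ => σ
  | assign x e, σ => σ.setReg x (e.eval σ)
  | put a e₁ e₂ e, σ => σ.setMem a (e₁.eval σ) (e₂.eval σ) (e.eval σ)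
  | seq P Q, σ => Q.run (P.run σ)
  | ite e P Q, σ => if e.eval σ ≠ 0 then P.run σ else Q.run σ
  | forLoop x P, σ => iter x P.run σ (σ.reg 0)

/-- The registers that are written. -/
def regs : LoopProgram → List ℕ
  | skip => []
  | assign x _ => [x]
  | put _ _ _ _ => []
  | seq P Q => P.regs ++ Q.regs
  | ite _ P Q => P.regs ++ Q.regs
  | forLoop x P => x :: P.regs

/-- The arrays that are written. -/
def arrays : LoopProgram → List ℕ
  | skip => []
  | assign _ _ => []
  | put a _ _ _ => [a]
  | seq P Q => P.arrays ++ Q.arrays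
  | ite _ P Q => P.arrays ++ Q.arrays
  | forLoop _ P => P.arrays

/-- No loop body writes its loop counter, and register `0` is never written. -/
def WellFormed : LoopProgram → Prop
  | skip => True
  | assign x _ => x ≠ 0
  | put _ _ _ _ => True
  | seq P Q => P.WellFormed ∧ Q.WellFormed
  | ite _ P Q => P.WellFormed ∧ Q.WellFormed
  | forLoop x P => x ≠ 0 ∧ x ∉ P.regs ∧ P.WellFormed

/-- A bound on the number of steps as a polynomial in the content of register `0`. -/
noncomputable def time : LoopProgram → Polynomial ℕ
  | skip => 1
  | assign _ e => .C (e.cost + 1)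
  | put _ e₁ e₂ e => .C (e₁.cost + e₂.cost + e.cost + 1)
  | seq P Q => P.time + Q.time
  | ite e P Q => .C (e.cost + 1) + (P.time + Q.time)
  | forLoop _ P => .C 6 + .X * (.C 8 + P.time)

theorem WellFormed.zero_notMem {P : LoopProgram} (h : P.WellFormed) : 0 ∉ P.regs := by
  induction P with
  | skip => simp [regs]
  | assign x e => simpa [regs] using fun h' : 0 = x => h h'.symm
  | put => simp [regs]
  | seq P Q ihP ihQ => simp [regs, ihP h.1, ihQ h.2]
  | ite e P Q ihP ihQ => simp [regs, ihP h.1, ihQ h.2]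
  | forLoop x P ih => simp [regs, ih h.2.2, h.1.symm]

theorem run_reg {P : LoopProgram} {y : ℕ} (h : y ∉ P.regs) (σ : Store) :
    (P.run σ).reg y = σ.reg y := by
  induction P generalizing σ with
  | skip => rfl
  | assign x e =>
    simp only [regs, List.mem_singleton] at h
    simp [run, Store.setReg, h]
  | put => rfl
  | seq P Q ihP ihQ =>
    simp only [regs, List.mem_append, not_or] at h
    simp [run, ihP h.1, ihQ h.2]
  | ite e P Q ihP ihQ =>
    simp only [regs, List.mem_append, not_or] at h
    simp only [run]
    split_ifs
    · exact ihP h.1 σ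
    · exact ihQ h.2 σ
  | forLoop x P ih =>
    simp only [regs, List.mem_cons, not_or] at h
    simp only [run]
    generalize σ.reg 0 = m
    induction m with
    | zero => simp [iter, Store.setReg, h.1]
    | succ m ihm => simpa [iter, Store.setReg, h.1, ih h.2] using ihm

theorem run_mem {P : LoopProgram} {a : ℕ} (h : a ∉ P.arrays) (σ : Store) :
    (P.run σ).mem a = σ.mem a := by
  induction P generalizing σ with
  | skip => rfl
  | assign x e => rfl
  | put b e₁ e₂ e =>
    simp only [arrays, List.mem_singleton] at h
    simp [run, Store.setMem, h]
  | seq P Q ihP ihQ =>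
    simp only [arrays, List.mem_append, not_or] at h
    simp [run, ihP h.1, ihQ h.2]
  | ite e P Q ihP ihQ =>
    simp only [arrays, List.mem_append, not_or] at h
    simp only [run]
    split_ifs
    · exact ihP h.1 σ
    · exact ihQ h.2 σ
  | forLoop x P ih =>
    simp only [arrays] at h
    simp only [run]
    generalize σ.reg 0 = m
    induction m with
    | zero => rfl
    | succ m ihm => simpa [iter, Store.setReg, ih h] using ihm

/-- Every loop runs as often as register `0` says, and that register never changes. So the bound
depends on the number of vertices alone, not on `k₁` or `k₂`. -/
theorem exec_compile {P : LoopProgram} (h : P.WellFormed) (σ : Store) :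
    ∃ t, Exec P.compile σ t (P.run σ) ∧ t ≤ P.time.eval (σ.reg 0) := by
  induction P generalizing σ with
  | skip => exact ⟨1, .skip σ, by simp [time]⟩
  | assign x e => exact ⟨_, .assign σ x e, by simp [time]⟩
  | put a e₁ e₂ e => exact ⟨_, .put σ a e₁ e₂ e, by simp [time]⟩
  | seq P Q ihP ihQ =>
    obtain ⟨t₁, h₁, ht₁⟩ := ihP h.1 σ
    obtain ⟨t₂, h₂, ht₂⟩ := ihQ h.2 (P.run σ)
    rw [run_reg h.1.zero_notMem] at ht₂
    exact ⟨t₁ + t₂, .seq h₁ h₂, by simp only [time, Polynomial.eval_add]; omega⟩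
  | ite e P Q ihP ihQ =>
    obtain ⟨t₁, h₁, ht₁⟩ := ihP h.1 σ
    obtain ⟨t₂, h₂, ht₂⟩ := ihQ h.2 σ
    by_cases he : e.eval σ ≠ 0
    · refine ⟨e.cost + 1 + t₁, ?_, ?_⟩
      · simp only [compile, run, if_pos he]
        exact .iteTrue he h₁
      · simp only [time, Polynomial.eval_add, Polynomial.eval_C]; omega
    · refine ⟨e.cost + 1 + t₂, ?_, ?_⟩
      · simp only [compile, run, if_neg he]
        exact .iteFalse (not_not.1 he) h₂
      · simp only [time, Polynomial.eval_add, Polynomial.eval_C]; omega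
  | forLoop x P ih =>
    obtain ⟨hx0, hxP, hP⟩ := h
    set n := σ.reg 0 with hn
    have hreg0 : ∀ m, (iter x P.run σ m).reg 0 = n := by
      intro m
      induction m with
      | zero => simp [iter, Store.setReg, hx0.symm, hn]
      | succ m ihm => simp [iter, Store.setReg, hx0.symm, run_reg hP.zero_notMem, ihm]
    have hregx : ∀ m, (iter x P.run σ m).reg x = m := by
      intro m
      cases m <;> simp [iter, Store.setReg]
    -- A loop test costs `4` and the increment another `4`, which gives `8` per round; the failing
    -- last test adds `4`, and setting the counter to `0` costs `2`.
    have hloop : ∀ d m, m + d = n → ∃ t,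
        Exec (.loop (.sub (.var 0) (.var x)) (.seq P.compile (.assign x (.add (.var x) (.const 1)))))
          (iter x P.run σ m) t (iter x P.run σ n) ∧ t ≤ 4 + d * (8 + P.time.eval n) := by
      intro d
      induction d with
      | zero =>
        rintro m rfl
        exact ⟨_, .loopFalse (by simp [Expr.eval, hreg0, hregx]), by simp [Expr.cost]⟩
      | succ d ihd =>
        intro m hm
        obtain ⟨t₁, h₁, ht₁⟩ := ih hP (iter x P.run σ m)
        obtain ⟨t₂, h₂, ht₂⟩ := ihd (m + 1) (by omega)
        rw [hreg0] at ht₁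
        have h₃ : Exec (.assign x (.add (.var x) (.const 1))) (P.run (iter x P.run σ m)) 4
            (iter x P.run σ (m + 1)) := by
          have := Exec.assign (P.run (iter x P.run σ m)) x (.add (.var x) (.const 1))
          simpa [Expr.cost, Expr.eval, run_reg hxP, hregx, iter] using this
        refine ⟨_, .loopTrue (by simp [Expr.eval, hreg0, hregx]; omega) (.seq h₁ h₃) h₂, ?_⟩
        simp only [Expr.cost]
        rw [Nat.succ_mul]
        omega
    obtain ⟨t, ht, htn⟩ := hloop n 0 (by omega)
    have h₀ : Exec (.assign x (.const 0)) σ 2 (iter x P.run σ 0) := .assign σ x (.const 0)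
    refine ⟨2 + t, .seq h₀ ht, ?_⟩
    simp only [time, Polynomial.eval_add, Polynomial.eval_C, Polynomial.eval_mul, Polynomial.eval_X]
    omega

/-- Two memory states agree outside the registers and arrays that `P` writes. -/
def Agree (P : LoopProgram) (σ τ : Store) : Prop :=
  (∀ y, y ∉ P.regs → τ.reg y = σ.reg y) ∧ ∀ a, a ∉ P.arrays → τ.mem a = σ.mem a

theorem agree_run (P : LoopProgram) (σ : Store) : P.Agree σ (P.run σ) :=
  ⟨fun _ h => run_reg h σ, fun _ h => run_mem h σ⟩

/-- The invariant rule for loops. -/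
theorem run_forLoop {x : ℕ} {P : LoopProgram} {σ : Store} (I : ℕ → Store → Prop)
    (h₀ : I 0 (σ.setReg x 0))
    (hstep : ∀ i < σ.reg 0, ∀ τ, (forLoop x P).Agree σ τ → τ.reg x = i → I i τ →
      I (i + 1) ((P.run τ).setReg x (i + 1))) :
    I (σ.reg 0) ((forLoop x P).run σ) := by
  have key : ∀ m ≤ σ.reg 0, I m (iter x P.run σ m) ∧ (forLoop x P).Agree σ (iter x P.run σ m) ∧
      (iter x P.run σ m).reg x = m := by
    intro m
    induction m with
    | zero =>
      refine fun _ => ⟨h₀, ⟨fun y hy => ?_, fun a _ => rfl⟩, by simp [iter, Store.setReg]⟩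
      simp only [regs, List.mem_cons, not_or] at hy
      simp [iter, Store.setReg, hy.1]
    | succ m ih =>
      intro hm
      obtain ⟨h1, h2, h3⟩ := ih (by omega)
      refine ⟨hstep m (by omega) _ h2 h3 h1, ⟨fun y hy => ?_, fun a ha => ?_⟩,
        by simp [iter, Store.setReg]⟩
      · have hy' := hy
        simp only [regs, List.mem_cons, not_or] at hy'
        simp only [iter, Store.setReg, if_neg hy'.1]
        rw [run_reg hy'.2, h2.1 y hy]
      · simp only [iter, Store.setReg]
        rw [run_mem (by simpa [arrays] using ha), h2.2 a ha]
  exact (key _ le_rfl).1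

end LoopProgram

end Language

end TwoPartition

namespace TwoPartition

open LoopProgram

/-! ### Counting, searching for arcs, and relaxing distances -/

section Subprograms

variable {n : ℕ}

/-- The set whose indicator vector is column `0` of array `a`. -/
def column (n a : ℕ) (τ : Store) : Set (Fin n) := {v | τ.mem a v 0 ≠ 0}

/-- Count in register `r` the values of register `x` for which `e` is nonzero. -/
def count (x r : ℕ) (e : Expr) : LoopProgram :=
  .seq (.assign r (.const 0)) (.forLoop x (.ite e (.assign r (.add (.var r) (.const 1))) .skip))

theorem run_count_mem (x r : ℕ) (e : Expr) (σ : Store) : ((count x r e).run σ).mem = σ.mem :=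
  funext fun _ => run_mem (by simp [count, arrays]) σ

theorem run_count_reg (x r : ℕ) (e : Expr) (σ : Store) {y : ℕ} (hx : y ≠ x) (hr : y ≠ r) :
    ((count x r e).run σ).reg y = σ.reg y :=
  run_reg (by simp [count, regs, hx, hr]) σ

theorem run_count {x r : ℕ} {e : Expr} {σ : Store} (p : Set (Fin n)) (hn : σ.reg 0 = n)
    (hr : r ≠ 0) (hrx : r ≠ x)
    (he : ∀ τ : Store, (∀ y, y ≠ x → y ≠ r → τ.reg y = σ.reg y) → τ.mem = σ.mem →
      ∀ v : Fin n, τ.reg x = v → (e.eval τ ≠ 0 ↔ v ∈ p)) :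
    ((count x r e).run σ).reg r = p.ncard := by
  have hn' : (σ.setReg r 0).reg 0 = n := by simp [Store.setReg, hr.symm, hn]
  have key := run_forLoop (σ := σ.setReg r 0) (x := x)
    (P := .ite e (.assign r (.add (.var r) (.const 1))) .skip)
    (fun i τ => τ.reg r = {v : Fin n | v ∈ p ∧ (v : ℕ) < i}.ncard)
    (by simp [Store.setReg, hrx]) (by
      intro i hi τ hag hx hI
      rw [hn'] at hi
      have h1 := he τ (fun y hyx hyr => by
        rw [hag.1 y (by simp [regs, hyx, hyr])]; simp [Store.setReg, hyr])
        (funext fun a => hag.2 a (by simp [arrays])) ⟨i, hi⟩ hx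
      simp only [run]
      by_cases hp : (⟨i, hi⟩ : Fin n) ∈ p
      · have h2 : {v : Fin n | v ∈ p ∧ (v : ℕ) < i + 1} =
            insert ⟨i, hi⟩ {v : Fin n | v ∈ p ∧ (v : ℕ) < i} := by
          ext v
          simp only [Set.mem_ofPred_eq, Set.mem_insert_iff, Fin.ext_iff]
          constructor
          · rintro ⟨h, h'⟩
            have : (v : ℕ) = i ∨ (v : ℕ) < i := by omega
            exact this.imp id fun h'' => ⟨h, h''⟩
          · rintro (h | h)
            · exact ⟨by rwa [show v = ⟨i, hi⟩ from Fin.ext h], by omega⟩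
            · exact ⟨h.1, by omega⟩
        rw [if_pos (h1.2 hp), h2, Set.ncard_insert_of_notMem (by simp), ← hI]
        simp [Store.setReg, hrx, Expr.eval]
      · have h2 : {v : Fin n | v ∈ p ∧ (v : ℕ) < i + 1} = {v : Fin n | v ∈ p ∧ (v : ℕ) < i} := by
          ext v
          simp only [Set.mem_ofPred_eq]
          refine and_congr_right fun h => ⟨fun h' => ?_, fun h' => by omega⟩
          rcases Nat.lt_succ_iff_lt_or_eq.1 h' with h'' | h''
          · exact h''
          · exact (hp (by rwa [show v = ⟨i, hi⟩ from Fin.ext h''] at h)).elim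
        rw [if_neg (fun h => hp (h1.1 h)), h2, ← hI]
        simp [Store.setReg, hrx])
  rw [hn'] at key
  simp only [count, run] at key ⊢
  have : σ.setReg r ((Expr.const 0).eval σ) = σ.setReg r 0 := rfl
  rw [this, key]
  congr 1
  ext v
  simp

/-- The arc `uv` leads from `A` to a vertex outside `A` and `F`. -/
def Addable (D : Digraph (Fin n)) (A F : Set (Fin n)) (u v : Fin n) : Prop :=
  u ∈ A ∧ D.Adj u v ∧ v ∉ A ∧ v ∉ F

/-- Look for an arc from the vertex in register `10`, if it is in the set in array `a`, to a vertex
outside the sets in the arrays `a` and `b`. -/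
def findFrom (a b : ℕ) : LoopProgram :=
  .forLoop 11
    (.ite (.get a (.var 10) (.const 0))
      (.ite (.get 0 (.var 10) (.var 11))
        (.ite (.get a (.var 11) (.const 0)) .skip
          (.ite (.get b (.var 11) (.const 0)) .skip
            (.seq (.assign 12 (.const 1)) (.assign 13 (.var 11)))))
        .skip)
      .skip)

/-- Look for an arc from the set in array `a` to a vertex outside the sets in the arrays `a` and
`b`. Register `12` tells whether there is one, register `13` holds its head. -/
def find (a b : ℕ) : LoopProgram :=
  .seq (.assign 12 (.const 0)) (.forLoop 10 (findFrom a b))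

theorem run_find_mem (a b : ℕ) (σ : Store) : ((find a b).run σ).mem = σ.mem :=
  funext fun _ => run_mem (by simp [find, findFrom, arrays]) σ

theorem run_find {D : Digraph (Fin n)} {a b : ℕ} {σ : Store} (hn : σ.reg 0 = n)
    (hadj : ∀ u v : Fin n, σ.mem 0 u v ≠ 0 ↔ D.Adj u v) :
    (((find a b).run σ).reg 12 ≠ 0 →
      ∃ u v, Addable D (column n a σ) (column n b σ) u v ∧ ((find a b).run σ).reg 13 = v) ∧
    (((find a b).run σ).reg 12 = 0 → ∀ u v, ¬ Addable D (column n a σ) (column n b σ) u v) := by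
  -- `Q` describes the pairs inspected so far, so one invariant serves both nested loops.
  let J : (Fin n → Fin n → Prop) → Store → Prop := fun Q τ =>
    (τ.reg 12 ≠ 0 → ∃ u v : Fin n, Addable D (column n a σ) (column n b σ) u v ∧ τ.reg 13 = v) ∧
    (τ.reg 12 = 0 → ∀ u v, Q u v → ¬ Addable D (column n a σ) (column n b σ) u v)
  have hJ : ∀ {Q Q' : Fin n → Fin n → Prop} {τ τ' : Store}, J Q τ → τ'.reg 12 = τ.reg 12 →
      τ'.reg 13 = τ.reg 13 → (∀ u v, Q' u v → Q u v ∨ ¬ Addable D (column n a σ) (column n b σ) u v) →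
      J Q' τ' := by
    intro Q Q' τ τ' h h12 h13 hQ
    refine ⟨fun h' => ?_, fun h' u v huv => ?_⟩
    · rw [h12] at h'
      rw [h13]
      exact h.1 h'
    · rw [h12] at h'
      exact (hQ u v huv).elim (h.2 h' u v) id
  have hn' : (σ.setReg 12 0).reg 0 = n := hn
  have key : J (fun u _ => (u : ℕ) < (σ.setReg 12 0).reg 0) ((find a b).run σ) := by
    refine run_forLoop (σ := σ.setReg 12 0) (fun i => J fun u _ => (u : ℕ) < i) ?_ ?_
    · refine ⟨fun h => (h rfl).elim, fun _ u v h => (Nat.not_lt_zero _ h).elim⟩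
    intro i hi τ hag hx hI
    rw [hn'] at hi
    have hτn : τ.reg 0 = n := by rw [hag.1 0 (by simp [findFrom, regs])]; exact hn'
    have hin : J (fun u v => (u : ℕ) < i ∨ (u = ⟨i, hi⟩ ∧ (v : ℕ) < τ.reg 0)) ((findFrom a b).run τ) := by
      refine run_forLoop (x := 11) (σ := τ)
        (fun j => J fun u v => (u : ℕ) < i ∨ (u = ⟨i, hi⟩ ∧ (v : ℕ) < j)) ?_ ?_
      · exact hJ hI rfl rfl fun u v h => Or.inl (h.resolve_right (by simp))
      intro j hj ρ hag' hy hρ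
      rw [hτn] at hj
      have hmem : ρ.mem = σ.mem := funext fun c => by
        rw [hag'.2 c (by simp [arrays]), hag.2 c (by simp [findFrom, arrays])]; rfl
      have hx' : ρ.reg 10 = i := by rw [hag'.1 10 (by simp [regs])]; exact hx
      have hnew : ¬ Addable D (column n a σ) (column n b σ) ⟨i, hi⟩ ⟨j, hj⟩ → ∀ u v : Fin n,
          (u : ℕ) < i ∨ (u = ⟨i, hi⟩ ∧ (v : ℕ) < j + 1) →
          ((u : ℕ) < i ∨ (u = ⟨i, hi⟩ ∧ (v : ℕ) < j)) ∨
            ¬ Addable D (column n a σ) (column n b σ) u v := by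
        rintro hnot u v (h | ⟨rfl, h⟩)
        · exact Or.inl (Or.inl h)
        · rcases Nat.lt_succ_iff_lt_or_eq.1 h with h' | h'
          · exact Or.inl (Or.inr ⟨rfl, h'⟩)
          · right
            rwa [show v = ⟨j, hj⟩ from Fin.ext h']
      have hadj' := hadj ⟨i, hi⟩ ⟨j, hj⟩
      simp only [run, Expr.eval, hx', hy, hmem]
      split_ifs with h1 h2 h3 h4
      · exact hJ hρ rfl rfl (hnew fun h => h.2.2.1 h3)
      · exact hJ hρ rfl rfl (hnew fun h => h.2.2.2 h4)
      · refine ⟨fun _ => ⟨⟨i, hi⟩, ⟨j, hj⟩, ⟨h1, hadj'.1 h2, h3, h4⟩, ?_⟩, fun h => ?_⟩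
        · simpa [Store.setReg] using hy
        · simp [Store.setReg] at h
      · exact hJ hρ rfl rfl (hnew fun h => h2 (hadj'.2 h.2.1))
      · exact hJ hρ rfl rfl (hnew fun h => h1 h.1)
    refine hJ hin rfl rfl fun u v h => Or.inl ?_
    rcases Nat.lt_succ_iff_lt_or_eq.1 h with h' | h'
    · exact Or.inl h'
    · exact Or.inr ⟨Fin.ext h', by rw [hτn]; exact v.2⟩
  rw [hn'] at key
  exact ⟨key.1, fun h u v => key.2 h u v u.2⟩

/-- The weight of a vertex is one if it is an out-neighbour of `s`, and zero otherwise. -/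
noncomputable def weight (D : Digraph (Fin n)) (s v : Fin n) : ℕ :=
  ({v} ∩ outNeighbors D s : Set (Fin n)).ncard

/-- The part of the memory state that the subprograms only read. -/
structure Env (D : Digraph (Fin n)) (k₁ k₂ : ℕ) (s : Fin n) (τ : Store) : Prop where
  reg0 : τ.reg 0 = n
  reg1 : τ.reg 1 = k₁
  reg2 : τ.reg 2 = k₂
  reg3 : τ.reg 3 = s
  adj : ∀ u v : Fin n, τ.mem 0 u v ≠ 0 ↔ D.Adj u v
  adj_row : ∀ v : Fin n, τ.mem 0 s v = weight D s v

theorem Env.of_agree {D : Digraph (Fin n)} {k₁ k₂ : ℕ} {s : Fin n} {P : LoopProgram} {σ τ : Store}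
    (h : Env D k₁ k₂ s σ) (hag : P.Agree σ τ) (hP : ∀ y < 4, y ∉ P.regs) (hP' : 0 ∉ P.arrays) :
    Env D k₁ k₂ s τ := by
  have h0 := hag.2 0 hP'
  refine ⟨?_, ?_, ?_, ?_, ?_, ?_⟩
  · rw [hag.1 _ (hP _ (by norm_num)), h.reg0]
  · rw [hag.1 _ (hP _ (by norm_num)), h.reg1]
  · rw [hag.1 _ (hP _ (by norm_num)), h.reg2]
  · rw [hag.1 _ (hP _ (by norm_num)), h.reg3]
  · rw [h0]; exact h.adj
  · rw [h0]; exact h.adj_row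

/-- Write the weights of the arcs from the vertex in register `15` to the set in array `3` into a row
of array `4`; the entry `n + 1` stands for infinity. -/
def initRow : LoopProgram :=
  .forLoop 17 (.seq
    (.put 4 (.var 15) (.var 17) (.add (.var 0) (.const 1)))
    (.ite (.get 3 (.var 17) (.const 0))
      (.ite (.get 0 (.var 15) (.var 17))
        (.put 4 (.var 15) (.var 17) (.get 0 (.var 3) (.var 17)))
        .skip)
      .skip))

/-- Write the weights of the arcs with head in the set in array `3` into array `4`. -/
def initDistances : LoopProgram := .forLoop 15 initRow

/-- Shorten the distances from the vertex in register `15` by the stop in register `16`. -/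
def relaxVia : LoopProgram :=
  .forLoop 17
    (.ite (.sub (.get 4 (.var 15) (.var 17))
        (.add (.get 4 (.var 15) (.var 16)) (.get 4 (.var 16) (.var 17))))
      (.put 4 (.var 15) (.var 17)
        (.add (.get 4 (.var 15) (.var 16)) (.get 4 (.var 16) (.var 17))))
      .skip)

/-- Shorten the distances from the vertex in register `15` by one intermediate stop. -/
def relaxRow : LoopProgram := .forLoop 16 relaxVia

/-- Shorten all distances by one intermediate stop. -/
def relaxDistances : LoopProgram := .forLoop 15 relaxRow

theorem run_initDistances {D : Digraph (Fin n)} {k₁ k₂ : ℕ} {s : Fin n} {σ : Store}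
    (h : Env D k₁ k₂ s σ) (i j : Fin n) :
    (j ∈ column n 3 σ ∧ D.Adj i j ∧ (initDistances.run σ).mem 4 i j = weight D s j) ∨
    (¬ (j ∈ column n 3 σ ∧ D.Adj i j) ∧ (initDistances.run σ).mem 4 i j = n + 1) := by
  let E : Store → Fin n → Fin n → Prop := fun τ i j =>
    (j ∈ column n 3 σ ∧ D.Adj i j ∧ τ.mem 4 i j = weight D s j) ∨
    (¬ (j ∈ column n 3 σ ∧ D.Adj i j) ∧ τ.mem 4 i j = n + 1)
  have key : ∀ i j : Fin n, (i : ℕ) < σ.reg 0 → E (initDistances.run σ) i j := by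
    refine run_forLoop (fun a τ => ∀ i j : Fin n, (i : ℕ) < a → E τ i j)
      (fun i j h => (Nat.not_lt_zero _ h).elim) ?_
    intro a ha τ hag hx hI
    rw [h.reg0] at ha
    have hτ : Env D k₁ k₂ s τ := h.of_agree hag (by simp +decide) (by simp [initRow, arrays])
    have hin : ∀ i j : Fin n, (i : ℕ) < a ∨ (i : ℕ) = a ∧ (j : ℕ) < τ.reg 0 → E (initRow.run τ) i j := by
      refine run_forLoop (x := 17) (σ := τ)
        (fun b τ => ∀ i j : Fin n, (i : ℕ) < a ∨ (i : ℕ) = a ∧ (j : ℕ) < b → E τ i j)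
        (fun i j h => hI i j (h.resolve_right (by simp))) ?_
      intro b hb ρ hag' hy hρ i j hij
      rw [hτ.reg0] at hb
      have hρe : Env D k₁ k₂ s ρ := hτ.of_agree hag' (by simp +decide) (by simp [arrays])
      have h3 : ρ.mem 3 = σ.mem 3 := by
        rw [hag'.2 3 (by simp [arrays]), hag.2 3 (by simp [initRow, arrays])]
      have hx' : ρ.reg 15 = a := by rw [hag'.1 15 (by simp [regs])]; exact hx
      have hadj := hρe.adj ⟨a, ha⟩ ⟨b, hb⟩
      have hrow := hρe.adj_row ⟨b, hb⟩
      simp only [run, Expr.eval]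
      by_cases hcase : (i : ℕ) = a ∧ (j : ℕ) = b
      · obtain rfl : i = ⟨a, ha⟩ := Fin.ext hcase.1
        obtain rfl : j = ⟨b, hb⟩ := Fin.ext hcase.2
        have h1 : (⟨b, hb⟩ : Fin n) ∈ column n 3 σ ↔ ρ.mem 3 b 0 ≠ 0 := by rw [h3]; rfl
        simp only at hadj hrow
        by_cases h4 : ρ.mem 3 b 0 ≠ 0
        · by_cases h5 : ρ.mem 0 a b ≠ 0
          · exact Or.inl ⟨h1.2 h4, hadj.1 h5, by
              simp [hx', hy, hρe.reg3, h4, h5, hrow, Store.setMem_mem]⟩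
          · exact Or.inr ⟨fun h => h5 (hadj.2 h.2), by
              simp [hx', hy, hρe.reg0, h4, not_not.1 h5, Store.setMem_mem]⟩
        · exact Or.inr ⟨fun h => h4 (h1.1 h.1), by
            simp [hx', hy, hρe.reg0, not_not.1 h4, Store.setMem_mem]⟩
      · have hold := hρ i j (by omega)
        have hc : ∀ (c : ℕ) (π : Store), (π.setMem 4 a b c).mem 4 i j = π.mem 4 i j := by
          intro c π
          rw [Store.setMem_mem, if_neg hcase]
        simp only [E, Store.setReg_mem, hx', hy] at hold ⊢
        split_ifs <;> simpa only [Store.setMem_reg, hx', hy, hc] using hold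
    intro i j hij
    refine hin i j ?_
    rw [hτ.reg0]
    omega
  exact key i j (by rw [h.reg0]; exact i.2)

/-- Soundness is required only for entries up to `n`, since `n + 1` encodes infinity and sums with
it exceed `n`. The update is in place, so the new entries may be smaller than one round of
relaxation would give. -/
theorem run_relaxDistances {D : Digraph (Fin n)} {U X : Set (Fin n)} {σ : Store}
    (hn : σ.reg 0 = n)
    (hsound : ∀ i j : Fin n, σ.mem 4 i j ≤ n → Linked D U X i (σ.mem 4 i j) j) :
    (∀ i j : Fin n, (relaxDistances.run σ).mem 4 i j ≤ n →
      Linked D U X i ((relaxDistances.run σ).mem 4 i j) j) ∧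
    (∀ i j : Fin n, (relaxDistances.run σ).mem 4 i j ≤ σ.mem 4 i j) ∧
    ∀ i m j : Fin n, (relaxDistances.run σ).mem 4 i j ≤ σ.mem 4 i m + σ.mem 4 m j := by
  let J : (Fin n → Fin n → Fin n → Prop) → Store → Prop := fun Q τ =>
    (∀ i j : Fin n, τ.mem 4 i j ≤ n → Linked D U X i (τ.mem 4 i j) j) ∧
    (∀ i j : Fin n, τ.mem 4 i j ≤ σ.mem 4 i j) ∧
    ∀ i m j : Fin n, Q i m j → τ.mem 4 i j ≤ σ.mem 4 i m + σ.mem 4 m j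
  have hJ : ∀ {Q Q' : Fin n → Fin n → Fin n → Prop} {τ τ' : Store}, J Q τ → τ'.mem = τ.mem →
      (∀ i m j, Q' i m j → Q i m j) → J Q' τ' := by
    intro Q Q' τ τ' h hm hQ
    simp only [J, hm]
    exact ⟨h.1, h.2.1, fun i m j hq => h.2.2 i m j (hQ i m j hq)⟩
  have key : J (fun i _ _ => (i : ℕ) < σ.reg 0) (relaxDistances.run σ) := by
    refine run_forLoop (fun a => J fun i _ _ => (i : ℕ) < a)
      ⟨hsound, fun _ _ => le_rfl, fun _ _ _ h => (Nat.not_lt_zero _ h).elim⟩ ?_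
    intro a ha τ hag hx hI
    have hτn : τ.reg 0 = n := by rw [hag.1 0 (by simp [relaxRow, relaxVia, regs]), hn]
    have hin : J (fun i m _ => (i : ℕ) < a ∨ (i : ℕ) = a ∧ (m : ℕ) < τ.reg 0) (relaxRow.run τ) := by
      refine run_forLoop (x := 16) (σ := τ)
        (fun b => J fun i m _ => (i : ℕ) < a ∨ (i : ℕ) = a ∧ (m : ℕ) < b)
        (hJ hI rfl fun i m j h => h.resolve_right (by simp)) ?_
      intro b hb ρ hag' hy hρ
      have hρn : ρ.reg 0 = n := by rw [hag'.1 0 (by simp [relaxVia, regs]), hτn]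
      have hx' : ρ.reg 15 = a := by rw [hag'.1 15 (by simp [relaxVia, regs])]; exact hx
      have hin' : J (fun i m j => (i : ℕ) < a ∨ (i : ℕ) = a ∧ (m : ℕ) < b ∨
          ((i : ℕ) = a ∧ (m : ℕ) = b) ∧ (j : ℕ) < ρ.reg 0) (relaxVia.run ρ) := by
        refine run_forLoop (x := 17) (σ := ρ)
          (fun c => J fun i m j => (i : ℕ) < a ∨ (i : ℕ) = a ∧ (m : ℕ) < b ∨
            ((i : ℕ) = a ∧ (m : ℕ) = b) ∧ (j : ℕ) < c)
          (hJ hρ rfl fun i m j h => by omega) ?_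
        intro c hc π hag'' hz hπ
        have hx'' : π.reg 15 = a := by rw [hag''.1 15 (by simp [regs])]; exact hx'
        have hy'' : π.reg 16 = b := by rw [hag''.1 16 (by simp [regs])]; exact hy
        rw [hn] at ha
        rw [hτn] at hb
        rw [hρn] at hc
        simp only [run, Expr.eval, hx'', hy'', hz]
        -- The entries being added may already have been overwritten, but only by smaller values, so
        -- their sum is still below the old one.
        have h1 := hπ.2.1 ⟨a, ha⟩ ⟨b, hb⟩
        have h2 := hπ.2.1 ⟨b, hb⟩ ⟨c, hc⟩
        simp only at h1 h2
        have hmem : ∀ e p q, ((π.setMem 4 a c e).setReg 17 (c + 1)).mem 4 p q =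
            if p = a ∧ q = c then e else π.mem 4 p q := by
          intro e p q
          simp [Store.setReg, Store.setMem]
        split_ifs with hlt
        · refine ⟨fun i j hij => ?_, fun i j => ?_, fun i m j hq => ?_⟩
          · rw [hmem] at hij ⊢
            split_ifs at hij ⊢ with hcase
            · obtain rfl : i = ⟨a, ha⟩ := Fin.ext hcase.1
              obtain rfl : j = ⟨c, hc⟩ := Fin.ext hcase.2
              exact (hπ.1 ⟨a, ha⟩ ⟨b, hb⟩ (by simp only; omega)).trans
                (hπ.1 ⟨b, hb⟩ ⟨c, hc⟩ (by simp only; omega))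
            · exact hπ.1 i j hij
          · rw [hmem]
            split_ifs with hcase
            · refine le_trans ?_ (hπ.2.1 i j)
              rw [hcase.1, hcase.2]
              omega
            · exact hπ.2.1 i j
          · rw [hmem]
            split_ifs with hcase
            · by_cases hm : (m : ℕ) = b
              · rw [hcase.1, hcase.2, hm]
                omega
              · have := hπ.2.2 i m j (by omega)
                rw [hcase.1, hcase.2] at this ⊢
                omega
            · exact hπ.2.2 i m j (by omega)
        · refine ⟨hπ.1, hπ.2.1, fun i m j hq => ?_⟩
          by_cases hcase : ((i : ℕ) = a ∧ (m : ℕ) = b) ∧ (j : ℕ) = c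
          · change π.mem 4 i j ≤ _
            rw [hcase.1.1, hcase.1.2, hcase.2]
            omega
          · exact hπ.2.2 i m j (by omega)
      refine hJ hin' rfl fun i m j h => ?_
      have := j.2
      omega
    refine hJ hin rfl fun i m j h => ?_
    have := m.2
    omega
  rw [hn] at key
  exact ⟨key.1, key.2.1, fun i m j => key.2.2 i m j i.2⟩

end Subprograms

end TwoPartition

namespace TwoPartition

open LoopProgram

/-! ### Detecting and extracting light sets -/

section Elimination

variable {n : ℕ}

/-- Write the least weights of walks of positive length, all of whose vertices but the first lie in
the set in array `3`, into array `4`. -/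
def distances : LoopProgram := .seq initDistances (.forLoop 14 relaxDistances)

/-- Each round of relaxation extends the covered walks by one arc. The walk `c` is indexed against
its arcs, so it starts at `c m`, and the heads of its arcs, which carry the weight, are `c t` for `t
< m`. -/
theorem run_distances {D : Digraph (Fin n)} {k₁ k₂ : ℕ} {s : Fin n} {σ : Store}
    (h : Env D k₁ k₂ s σ) :
    (∀ i j : Fin n, (distances.run σ).mem 4 i j ≤ n →
      Linked D (column n 3 σ) (outNeighbors D s) i ((distances.run σ).mem 4 i j) j) ∧
    ∀ c : ℕ → Fin n, (∀ t, c t ∈ column n 3 σ ∧ D.Adj (c (t + 1)) (c t)) → ∀ m, 1 ≤ m → m ≤ n + 1 →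
      (distances.run σ).mem 4 (c m) (c 0) ≤ ∑ t ∈ Finset.range m, weight D s (c t) := by
  have h0 : (initDistances.run σ).reg 0 = n := by rw [run_reg (by decide), h.reg0]
  have key := run_forLoop (x := 14) (P := relaxDistances) (σ := initDistances.run σ) (fun l τ =>
    (∀ i j : Fin n, τ.mem 4 i j ≤ n →
      Linked D (column n 3 σ) (outNeighbors D s) i (τ.mem 4 i j) j) ∧
    ∀ c : ℕ → Fin n, (∀ t, c t ∈ column n 3 σ ∧ D.Adj (c (t + 1)) (c t)) → ∀ m, 1 ≤ m → m ≤ l + 1 →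
      τ.mem 4 (c m) (c 0) ≤ ∑ t ∈ Finset.range m, weight D s (c t)) ?_ ?_
  · rwa [h0] at key
  · refine ⟨fun i j hij => ?_, fun c hc m hm1 hm => ?_⟩
    · rw [Store.setReg_mem] at hij ⊢
      rcases run_initDistances h i j with ⟨h1, h2, h3⟩ | ⟨-, h3⟩
      · rw [h3]
        exact Linked.of_adj h1 h2
      · omega
    · obtain rfl : m = 1 := by omega
      rcases run_initDistances h (c 1) (c 0) with ⟨h1, h2, h3⟩ | ⟨h1, -⟩
      · simp [h3]
      · exact (h1 (hc 0)).elim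
  · intro l hl τ hag hx hI
    have hτ : τ.reg 0 = n := by rw [hag.1 0 (by decide), h0]
    obtain ⟨h1, h2, h3⟩ := run_relaxDistances hτ hI.1
    refine ⟨h1, fun c hc m hm1 hm => ?_⟩
    rw [Store.setReg_mem]
    by_cases hml : m ≤ l + 1
    · exact (h2 _ _).trans (hI.2 c hc m hm1 hml)
    obtain ⟨m, rfl⟩ : ∃ m', m = m' + 1 := ⟨m - 1, by omega⟩
    refine (h3 _ (c m) _).trans ?_
    rw [Finset.sum_range_succ, add_comm]
    refine Nat.add_le_add (hI.2 c hc m (by omega) (by omega)) ?_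
    have := hI.2 (fun t => c (m + t)) (fun t => hc (m + t)) 1 le_rfl (by omega)
    simpa using this

theorem sum_weight_le {D : Digraph (Fin n)} {s : Fin n} {c : ℕ → Fin n} {p : ℕ}
    (hinj : Set.InjOn c (Set.Iio p)) {S : Set (Fin n)} (hc : ∀ t, c t ∈ S) :
    ∑ t ∈ Finset.range p, weight D s (c t) ≤ (S ∩ outNeighbors D s).ncard := by
  suffices ∀ m ≤ p, ∑ t ∈ Finset.range m, weight D s (c t) ≤
      (c '' Set.Iio m ∩ outNeighbors D s).ncard from
    (this p le_rfl).trans (Set.ncard_le_ncard (Set.inter_subset_inter_left _ (by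
      rintro _ ⟨t, -, rfl⟩
      exact hc t)))
  intro m
  induction m with
  | zero => simp
  | succ m ih =>
    intro hm
    rw [Finset.sum_range_succ]
    refine (Nat.add_le_add_right (ih (by omega)) _).trans ?_
    unfold weight
    rw [← Set.ncard_union_eq]
    · refine Set.ncard_le_ncard ?_
      rw [← Set.union_inter_distrib_right]
      refine Set.inter_subset_inter_left _ ?_
      rintro v (⟨t, ht, rfl⟩ | rfl)
      · exact ⟨t, Nat.lt_succ_of_lt ht, rfl⟩
      · exact ⟨m, Nat.lt_succ_self m, rfl⟩
    · refine Set.disjoint_left.2 ?_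
      rintro _ ⟨⟨t, ht, rfl⟩, -⟩ ⟨h, -⟩
      have : t < m := ht
      have := hinj (show t < p by omega) (show m < p by omega) h
      omega

/-- The registers and arrays that are only read, after the bound on the weight of a cycle has been
computed. -/
structure Ready (D : Digraph (Fin n)) (k₁ k₂ : ℕ) (s : Fin n) (τ : Store) : Prop extends
    Env D k₁ k₂ s τ where
  reg4 : τ.reg 4 = lightBound D k₁ k₂ s

theorem Ready.of_agree {D : Digraph (Fin n)} {k₁ k₂ : ℕ} {s : Fin n} {P : LoopProgram}
    {σ τ : Store} (h : Ready D k₁ k₂ s σ) (hag : P.Agree σ τ) (hP : ∀ y < 5, y ∉ P.regs)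
    (hP' : 0 ∉ P.arrays) : Ready D k₁ k₂ s τ where
  toEnv := h.toEnv.of_agree hag (fun y hy => hP y (by omega)) hP'
  reg4 := by rw [hag.1 _ (hP _ (by norm_num)), h.reg4]

theorem Ready.run {D : Digraph (Fin n)} {k₁ k₂ : ℕ} {s : Fin n} {σ : Store}
    (h : Ready D k₁ k₂ s σ) (P : LoopProgram) (hP : ∀ y < 5, y ∉ P.regs)
    (hP' : 0 ∉ P.arrays) : Ready D k₁ k₂ s (P.run σ) :=
  h.of_agree (agree_run P σ) hP hP'

theorem Ready.setMem {D : Digraph (Fin n)} {k₁ k₂ : ℕ} {s : Fin n} {σ : Store}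
    (h : Ready D k₁ k₂ s σ) {a : ℕ} (ha : 0 ≠ a) (i j c : ℕ) :
    Ready D k₁ k₂ s (σ.setMem a i j c) :=
  h.of_agree (P := .put a (.const i) (.const j) (.const c)) (agree_run _ σ) (by simp [regs])
    (by simpa [arrays] using ha)

/-- Register `18` tells whether the set in array `3` has a nonempty subset of minimum in-degree at
least one whose weight is at most the content of register `4`. -/
def testLight : LoopProgram :=
  .seq distances (count 19 18 (.sub (.const 1) (.sub (.get 4 (.var 19) (.var 19)) (.var 4))))

/-- A light set contains a cycle, whose total weight is at most that of the set because its vertices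
are distinct. Conversely, a diagonal entry within the bound yields a light set through
`Linked.hasLightSet`. -/
theorem run_testLight {D : Digraph (Fin n)} {k₁ k₂ : ℕ} {s : Fin n} {σ : Store}
    (h : Ready D k₁ k₂ s σ) :
    (testLight.run σ).reg 18 ≠ 0 ↔
      HasLightSet D (column n 3 σ) (outNeighbors D s) (lightBound D k₁ k₂ s) := by
  have hd : Ready D k₁ k₂ s (distances.run σ) := h.run _ (by decide) (by decide)
  obtain ⟨hsound, hcomplete⟩ := run_distances h.toEnv
  have hc : (testLight.run σ).reg 18 =
      {v : Fin n | (distances.run σ).mem 4 v v ≤ lightBound D k₁ k₂ s}.ncard := by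
    refine run_count _ hd.reg0 (by decide) (by decide) fun τ hτ hmem v hv => ?_
    -- With truncated subtraction, `1 - (d - M)` is nonzero exactly when `d ≤ M`.
    simp only [Expr.eval, hmem, hv, hτ 4 (by decide) (by decide), hd.reg4, Set.mem_ofPred_eq]
    omega
  rw [hc, ← Nat.pos_iff_ne_zero, Set.ncard_pos]
  constructor
  · rintro ⟨v, hv⟩
    rw [Set.mem_ofPred_eq] at hv
    -- Thus an entry `n + 1`, which stands for infinity, never passes the test.
    have hn : lightBound D k₁ k₂ s ≤ n := by
      have := Set.ncard_le_ncard (Set.subset_univ (outNeighbors D s))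
      rw [Set.ncard_univ, Nat.card_fin] at this
      unfold lightBound
      omega
    exact ((hsound v v (hv.trans hn)).mono hv).hasLightSet
  · rintro ⟨S, hSU, hne, hS, hSc⟩
    obtain ⟨c, p, hp, hpn, hcp, hc, hinj⟩ := hS.exists_cycle hne
    rw [Nat.card_fin] at hpn
    refine ⟨c 0, ?_⟩
    have h1 := hcomplete c (fun t => ⟨hSU (hc t).1, (hc t).2⟩) p hp (by omega)
    rw [hcp] at h1
    exact h1.trans ((sum_weight_le hinj fun t => (hc t).1).trans hSc)

/-- The rule for loops whose body rewrites the entry of the loop counter in column `0` of an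
array. -/
theorem run_forLoop_column {x a : ℕ} {P : LoopProgram} {σ : Store} (p : Set (Fin n))
    (hn : σ.reg 0 = n)
    (hstep : ∀ v : Fin n, ∀ τ, (forLoop x P).Agree σ τ → τ.reg x = v →
      τ.mem a v 0 = σ.mem a v 0 → ((P.run τ).mem a v 0 ≠ 0 ↔ v ∈ p) ∧
      ∀ i, i ≠ (v : ℕ) → (P.run τ).mem a i 0 = τ.mem a i 0) :
    column n a ((forLoop x P).run σ) = p := by
  have key := run_forLoop (x := x) (P := P) (σ := σ)
    (fun i τ => (∀ v : Fin n, (v : ℕ) < i → (τ.mem a v 0 ≠ 0 ↔ v ∈ p)) ∧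
      ∀ v : Fin n, i ≤ (v : ℕ) → τ.mem a v 0 = σ.mem a v 0)
    ⟨fun v hv => (Nat.not_lt_zero _ hv).elim, fun _ _ => rfl⟩ (by
      intro i hi τ hag hx hI
      rw [hn] at hi
      obtain ⟨h1, h2⟩ := hstep ⟨i, hi⟩ τ hag hx (hI.2 ⟨i, hi⟩ le_rfl)
      refine ⟨fun v hv => ?_, fun v hv => ?_⟩
      · rw [Store.setReg_mem]
        by_cases hvi : (v : ℕ) = i
        · obtain rfl : v = ⟨i, hi⟩ := Fin.ext hvi
          exact h1
        · rw [h2 v hvi]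
          exact hI.1 v (by omega)
      · rw [Store.setReg_mem, h2 v (show (v : ℕ) ≠ i by omega)]
        exact hI.2 v (by omega))
  rw [hn] at key
  ext v
  exact key.1 v v.2

theorem column_setMem_zero (a : ℕ) (τ : Store) (v : Fin n) :
    column n a (τ.setMem a v 0 0) = column n a τ \ {v} := by
  ext u
  simp only [column, Set.mem_ofPred_eq, Store.setMem_mem, Set.mem_sdiff, Set.mem_singleton_iff,
    Fin.ext_iff, and_true]
  split_ifs with h <;> simp [h]

theorem column_setMem_one (a : ℕ) (τ : Store) (v : Fin n) :
    column n a (τ.setMem a v 0 1) = insert v (column n a τ) := by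
  ext u
  simp only [column, Set.mem_ofPred_eq, Store.setMem_mem, Set.mem_insert_iff, Fin.ext_iff, and_true]
  split_ifs with h <;> simp [h]

theorem column_congr {a : ℕ} {σ τ : Store} (h : τ.mem a = σ.mem a) :
    column n a τ = column n a σ := by
  simp only [column, h]

/-- Write the set of the vertices other than `s` and outside the set in array `2` into array `3`. -/
def fillFree : LoopProgram :=
  .seq (.forLoop 20 (.ite (.get 2 (.var 20) (.const 0))
      (.put 3 (.var 20) (.const 0) (.const 0)) (.put 3 (.var 20) (.const 0) (.const 1))))
    (.put 3 (.var 3) (.const 0) (.const 0))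

theorem run_fillFree {D : Digraph (Fin n)} {k₁ k₂ : ℕ} {s : Fin n} {σ : Store}
    (h : Ready D k₁ k₂ s σ) : column n 3 (fillFree.run σ) = (insert s (column n 2 σ))ᶜ := by
  have h1 := run_forLoop_column (x := 20) (a := 3) (P := .ite (.get 2 (.var 20) (.const 0))
      (.put 3 (.var 20) (.const 0) (.const 0)) (.put 3 (.var 20) (.const 0) (.const 1)))
    (σ := σ) (column n 2 σ)ᶜ h.reg0 (by
      intro v τ hag hx _
      have h2 : v ∈ column n 2 σ ↔ τ.mem 2 v 0 ≠ 0 := by rw [hag.2 2 (by decide)]; rfl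
      rw [Set.mem_compl_iff, h2]
      simp only [run, Expr.eval, hx]
      split_ifs with h3
      · exact ⟨by simp [Store.setMem_mem, h3], fun i hi => by simp [Store.setMem_mem, hi]⟩
      · exact ⟨by simp [Store.setMem_mem, h3], fun i hi => by simp [Store.setMem_mem, hi]⟩)
  have h2 := h.run (.forLoop 20 (.ite (.get 2 (.var 20) (.const 0))
      (.put 3 (.var 20) (.const 0) (.const 0)) (.put 3 (.var 20) (.const 0) (.const 1))))
      (by decide) (by decide)
  rw [fillFree, run.eq_4]
  rw [run.eq_3]
  simp only [Expr.eval, h2.reg3]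
  rw [column_setMem_zero, h1]
  ext v
  simp [not_or, and_comm]

/-- Remove vertices from the set in array `3` as long as it keeps a light subset. -/
def shrink : LoopProgram :=
  .forLoop 21 (.ite (.get 3 (.var 21) (.const 0))
    (.seq (.put 3 (.var 21) (.const 0) (.const 0))
      (.seq testLight (.ite (.var 18) .skip (.put 3 (.var 21) (.const 0) (.const 1)))))
    .skip)

/-- One pass suffices for minimality: a vertex that could not be deleted from a larger set cannot be
deleted later, as `HasLightSet` is monotone in the ambient set. -/
theorem run_shrink {D : Digraph (Fin n)} {k₁ k₂ : ℕ} {s : Fin n} {σ : Store}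
    (h : Ready D k₁ k₂ s σ) :
    column n 3 (shrink.run σ) ⊆ column n 3 σ ∧
    (HasLightSet D (column n 3 σ) (outNeighbors D s) (lightBound D k₁ k₂ s) →
      HasLightSet D (column n 3 (shrink.run σ)) (outNeighbors D s) (lightBound D k₁ k₂ s)) ∧
    ∀ v ∈ column n 3 (shrink.run σ), ¬ HasLightSet D (column n 3 (shrink.run σ) \ {v})
      (outNeighbors D s) (lightBound D k₁ k₂ s) := by
  set X := outNeighbors D s
  set M := lightBound D k₁ k₂ s with hM
  let I : ℕ → Set (Fin n) → Prop := fun i U => U ⊆ column n 3 σ ∧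
    (HasLightSet D (column n 3 σ) X M → HasLightSet D U X M) ∧
    ∀ v ∈ U, (v : ℕ) < i → ¬ HasLightSet D (U \ {v}) X M
  have key : I (σ.reg 0) (column n 3 (shrink.run σ)) := by
    refine run_forLoop (fun i τ => I i (column n 3 τ))
      ⟨subset_rfl, id, fun v _ hv => (Nat.not_lt_zero _ hv).elim⟩ ?_
    intro i hi τ hag hx hI
    rw [h.reg0] at hi
    have hτ := h.of_agree hag (by decide) (by decide)
    change I (i + 1) (column n 3 (LoopProgram.run _ τ))
    have hi' : i = ((⟨i, hi⟩ : Fin n) : ℕ) := rfl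
    generalize (⟨i, hi⟩ : Fin n) = w at hi'
    subst hi'
    simp only [run, Expr.eval, hx]
    split_ifs with h1 h2
    all_goals try rw [run_reg (P := testLight) (y := 21) (by decide), Store.setMem_reg, hx]
    · have h2' := (run_testLight (hτ.setMem (by decide) w 0 0)).1 h2
      rw [column_congr (run_mem (by decide) _), column_setMem_zero]
      rw [column_setMem_zero] at h2'
      refine ⟨Set.sdiff_subset.trans hI.1, fun _ => h2', fun v hv hvi hl => ?_⟩
      have hne : (v : ℕ) ≠ w := fun he => hv.2 (Fin.ext he)
      exact hI.2.2 v hv.1 (by omega) (hl.mono (Set.sdiff_subset_sdiff_left Set.sdiff_subset))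
    · have h2' := fun h' => h2 ((run_testLight (hτ.setMem (by decide) w 0 0)).2 h')
      rw [column_setMem_zero] at h2'
      rw [column_setMem_one, column_congr (run_mem (by decide) _), column_setMem_zero,
        Set.insert_sdiff_singleton, Set.insert_eq_of_mem (show w ∈ column n 3 τ from h1)]
      refine ⟨hI.1, hI.2.1, fun v hv hvi => ?_⟩
      by_cases hvw : v = w
      · subst hvw
        exact h2'
      · have : (v : ℕ) ≠ w := fun he => hvw (Fin.ext he)
        exact hI.2.2 v hv (by omega)
    · refine ⟨hI.1, hI.2.1, fun v hv hvi => ?_⟩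
      have : (v : ℕ) ≠ w := by
        rintro he
        rw [Fin.ext he] at hv
        exact h1 hv
      exact hI.2.2 v hv (by omega)
  rw [h.reg0] at key
  exact ⟨key.1, key.2.1, fun v hv => key.2.2 v hv v.2⟩

/-- Add the set in array `3` to the set in array `2`. -/
def addSet : LoopProgram :=
  .forLoop 20 (.ite (.get 3 (.var 20) (.const 0)) (.put 2 (.var 20) (.const 0) (.const 1)) .skip)

theorem run_addSet {σ : Store} (h : σ.reg 0 = n) :
    column n 2 (addSet.run σ) = column n 2 σ ∪ column n 3 σ := by
  refine run_forLoop_column _ h ?_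
  intro v τ hag hx hv
  have h2 : v ∈ column n 2 σ ∪ column n 3 σ ↔ τ.mem 2 v 0 ≠ 0 ∨ τ.mem 3 v 0 ≠ 0 := by
    rw [hag.2 3 (by decide), hv]; rfl
  rw [h2]
  simp only [run, Expr.eval, hx]
  split_ifs with h3
  · exact ⟨by simp [Store.setMem_mem, h3], fun i hi => by simp [Store.setMem_mem, hi]⟩
  · exact ⟨by simp [h3], fun i hi => rfl⟩

/-- Add to the set in array `2` a light set of minimum in-degree at least one, if there is one. -/
def addLightSet : LoopProgram :=
  .seq fillFree (.seq shrink (.seq testLight (.ite (.var 18) addSet .skip)))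

/-- By minimality, a light subset of the shrunken set cannot omit any of its vertices, so the
shrunken set is itself light and no walk has to be traced back. -/
theorem run_addLightSet {D : Digraph (Fin n)} {k₁ k₂ : ℕ} {s : Fin n} {σ : Store}
    (h : Ready D k₁ k₂ s σ) :
    (column n 2 (addLightSet.run σ) = column n 2 σ ∧
      ¬ HasLightSet D (insert s (column n 2 σ))ᶜ (outNeighbors D s) (lightBound D k₁ k₂ s)) ∨
    ∃ S ⊆ (insert s (column n 2 σ))ᶜ, S.Nonempty ∧ MinInDegreeGeOne D S ∧
      (S ∩ outNeighbors D s).ncard ≤ lightBound D k₁ k₂ s ∧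
      column n 2 (addLightSet.run σ) = column n 2 σ ∪ S := by
  have h1 := h.run fillFree (by decide) (by decide)
  have h2 := h1.run shrink (by decide) (by decide)
  have h3 := h2.run testLight (by decide) (by decide)
  obtain ⟨hsub, hkeep, hmin⟩ := run_shrink h1
  rw [run_fillFree h] at hsub hkeep
  have ht := run_testLight h2
  have hW : column n 2 (testLight.run (shrink.run (fillFree.run σ))) = column n 2 σ := by
    rw [column_congr (run_mem (by decide) _), column_congr (run_mem (by decide) _),
      column_congr (run_mem (by decide) _)]
  have hU : column n 3 (testLight.run (shrink.run (fillFree.run σ))) =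
      column n 3 (shrink.run (fillFree.run σ)) := column_congr (run_mem (by decide) _)
  by_cases hflag : (testLight.run (shrink.run (fillFree.run σ))).reg 18 ≠ 0
  · right
    rw [show addLightSet.run σ = addSet.run (testLight.run (shrink.run (fillFree.run σ))) from
      if_pos hflag]
    obtain ⟨S, hSU, hne, hS, hSc⟩ := ht.1 hflag
    have hS' : S = column n 3 (shrink.run (fillFree.run σ)) := by
      refine hSU.antisymm fun v hv => ?_
      by_contra hvS
      exact hmin v hv ⟨S, fun u hu => ⟨hSU hu, fun he => hvS (he ▸ hu)⟩, hne, hS, hSc⟩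
    refine ⟨S, hSU.trans hsub, hne, hS, hSc, ?_⟩
    rw [run_addSet h3.reg0, hW, hU, hS']
  · left
    rw [show addLightSet.run σ = testLight.run (shrink.run (fillFree.run σ)) from if_neg hflag]
    exact ⟨hW, fun hl => hflag (ht.2 (hkeep hl))⟩

end Elimination

end TwoPartition

namespace TwoPartition

open LoopProgram

/-! ### The algorithms with given and with unknown root -/

section Main

variable {n : ℕ}

/-- Compute in register `4` the bound on the weight of a cycle. -/
def computeBound : LoopProgram :=
  .seq (count 28 4 (.get 0 (.var 3) (.var 28)))
    (.assign 4 (.sub (.sub (.var 4) (.var 1)) (.var 2)))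

theorem run_computeBound {D : Digraph (Fin n)} {k₁ k₂ : ℕ} {s : Fin n} {σ : Store}
    (h : Env D k₁ k₂ s σ) : Ready D k₁ k₂ s (computeBound.run σ) where
  toEnv := h.of_agree (agree_run _ σ) (by decide) (by decide)
  reg4 := by
    have hc : ((count 28 4 (.get 0 (.var 3) (.var 28))).run σ).reg 4 =
        (outNeighbors D s).ncard := by
      refine run_count _ h.reg0 (by decide) (by decide) fun τ hτ hmem v hv => ?_
      simp only [Expr.eval, hmem, hv, hτ 3 (by decide) (by decide), h.reg3]
      exact h.adj s v
    have h1 := h.of_agree (agree_run (count 28 4 (.get 0 (.var 3) (.var 28))) σ)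
      (by decide) (by decide)
    change _ - _ - _ = _
    simp only [Expr.eval, hc, h1.reg1, h1.reg2, lightBound]

/-- Make the set in array `a` empty. -/
def clear (a : ℕ) : LoopProgram := .forLoop 20 (.put a (.var 20) (.const 0) (.const 0))

theorem run_clear {a : ℕ} {σ : Store} (h : σ.reg 0 = n) : column n a ((clear a).run σ) = ∅ := by
  refine run_forLoop_column _ h fun v τ hag hx _ => ?_
  simp only [run, Expr.eval, hx]
  exact ⟨by simp [Store.setMem_mem], fun i hi => by simp [Store.setMem_mem, hi]⟩

/-- Make the set in array `a` the set `{s}`. -/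
def singleton (a : ℕ) : LoopProgram := .seq (clear a) (.put a (.var 3) (.const 0) (.const 1))

theorem run_singleton {D : Digraph (Fin n)} {k₁ k₂ : ℕ} {s : Fin n} {σ : Store} {a : ℕ}
    (ha : 0 ≠ a) (h : Ready D k₁ k₂ s σ) : column n a ((singleton a).run σ) = {s} := by
  have h1 := h.run (clear a) (by simp +decide [clear, regs]) (by simpa [clear, arrays] using ha)
  simp only [singleton, run.eq_4]
  rw [run.eq_3]
  simp only [Expr.eval, h1.reg3]
  rw [column_setMem_one, run_clear h.reg0, insert_empty_eq]

/-- Let the set in array `2` grow by an out-neighbour or by a cycle if it has fewer than `k₂`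
elements. -/
def growStep : LoopProgram :=
  .seq (count 24 23 (.get 2 (.var 24) (.const 0)))
    (.ite (.sub (.var 2) (.var 23))
      (.seq (find 2 6) (.ite (.var 12) (.put 2 (.var 13) (.const 0) (.const 1)) addLightSet))
      .skip)

/-- Let the set in array `2` grow by out-neighbours and cycles until it has `k₂` elements. -/
def grow : LoopProgram := .forLoop 22 growStep

theorem run_count_column {x r a : ℕ} {σ : Store} (hn : σ.reg 0 = n) (hr : r ≠ 0) (hrx : r ≠ x) :
    ((count x r (.get a (.var x) (.const 0))).run σ).reg r = (column n a σ).ncard := by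
  refine run_count _ hn hr hrx fun τ hτ hmem v hv => ?_
  simp only [Expr.eval, hmem, hv]
  rfl

/-- `Removable` is guaranteed for every root, and only size and lightness depend on the degree
condition. Trying arbitrary roots relies on this separation. -/
theorem run_grow {D : Digraph (Fin n)} {k₁ k₂ : ℕ} {s : Fin n} {σ : Store}
    (h : Ready D k₁ k₂ s σ) (hW : column n 2 σ = ∅) (hF : column n 6 σ = {s}) :
    Removable D s (column n 2 (grow.run σ)) ∧ (ManyBranchableOutNeighbors D k₁ k₂ s →
      k₂ ≤ (column n 2 (grow.run σ)).ncard ∧ IsLight D k₁ k₂ s (column n 2 (grow.run σ))) := by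
  let I : ℕ → Set (Fin n) → Prop := fun y W => Removable D s W ∧
    (ManyBranchableOutNeighbors D k₁ k₂ s →
      (y ≤ W.ncard ∨ k₂ ≤ W.ncard) ∧ IsLight D k₁ k₂ s W)
  have key : I (σ.reg 0) (column n 2 (grow.run σ)) := by
    refine run_forLoop (fun i τ => I i (column n 2 τ)) ?_ ?_
    · change I 0 (column n 2 σ)
      rw [hW]
      exact ⟨⟨id, fun v hv => hv.elim⟩, fun _ => ⟨Or.inl (Nat.zero_le _), by simp [IsLight]⟩⟩
    intro i hi τ hag _ hI
    change I (i + 1) (column n 2 (growStep.run τ))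
    have hτ := h.of_agree hag (by decide) (by decide)
    have hτF : column n 6 τ = {s} := by rw [column_congr (hag.2 6 (by decide)), hF]
    set W := column n 2 τ with hWdef
    set τ₁ := (count 24 23 (.get 2 (.var 24) (.const 0))).run τ with hτ₁
    have hτ₁r : Ready D k₁ k₂ s τ₁ := hτ.run _ (by decide) (by decide)
    have hmem₁ : τ₁.mem = τ.mem := run_count_mem _ _ _ _
    have hcount : τ₁.reg 23 = W.ncard := run_count_column hτ.reg0 (by decide) (by decide)
    set τ₂ := (find 2 6).run τ₁ with hτ₂
    have hτ₂r : Ready D k₁ k₂ s τ₂ := hτ₁r.run _ (by decide) (by decide)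
    have hmem₂ : τ₂.mem = τ.mem := (run_find_mem _ _ _).trans hmem₁
    have hW₂ : column n 2 τ₂ = W := column_congr (by rw [hmem₂])
    obtain ⟨hf1, hf2⟩ := run_find (a := 2) (b := 6) hτ₁r.reg0 hτ₁r.adj
    rw [column_congr (σ := τ) (a := 2) (by rw [hmem₁]), column_congr (σ := τ) (a := 6)
      (by rw [hmem₁]), hτF, ← hτ₂] at hf1 hf2
    obtain ⟨hrem, hmany⟩ := hI
    by_cases hsmall : τ₁.reg 2 - τ₁.reg 23 ≠ 0
    · have hlt : W.ncard < k₂ := by rw [hτ₁r.reg2, hcount] at hsmall; omega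
      by_cases hfound : τ₂.reg 12 ≠ 0
      · obtain ⟨u, v, ⟨hu, huv, hv, hvs⟩, h13⟩ := hf1 hfound
        have hres : column n 2 (growStep.run τ) = insert v W := by
          rw [show growStep.run τ = τ₂.setMem 2 (τ₂.reg 13) 0 1 from
            (if_pos hsmall).trans (if_pos hfound), h13, column_setMem_one, hW₂]
        rw [hres]
        refine ⟨⟨?_, hrem.2.insert hu huv⟩, fun hm => ⟨?_, isLight_insert hm hlt⟩⟩
        · rintro (hs | hs)
          · exact hvs hs.symm
          · exact hrem.1 hs
        · rw [Set.ncard_insert_of_notMem hv]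
          exact (hmany hm).1.imp Nat.succ_le_succ Nat.le_succ_of_le
      · have hclosed : ∀ u ∈ W, ∀ v, D.Adj u v → v ∉ W → v = s := by
          intro u hu v huv hv
          by_contra hvs
          exact hf2 (not_not.1 hfound) u v ⟨hu, huv, hv, hvs⟩
        rw [show growStep.run τ = addLightSet.run τ₂ from
          (if_pos hsmall).trans (if_neg hfound)]
        rcases run_addLightSet hτ₂r with ⟨h1, h2⟩ | ⟨S, hSG, ⟨x, hx⟩, hS, hSc, h1⟩
        · rw [h1, hW₂] at *
          exact ⟨hrem, fun hm => (h2 (hasLightSet_of_closed hm hlt hclosed)).elim⟩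
        · rw [hW₂] at h1 hSG
          rw [h1]
          refine ⟨⟨?_, hrem.2.union hS⟩, fun hm => ⟨?_, isLight_union hlt hSc⟩⟩
          · rintro (hs | hs)
            · exact hrem.1 hs
            · exact hSG hs (Or.inl rfl)
          · have : (insert x W).ncard ≤ (W ∪ S).ncard :=
              Set.ncard_le_ncard (Set.insert_subset (Or.inr hx) Set.subset_union_left)
            rw [Set.ncard_insert_of_notMem fun hxW => hSG hx (Or.inr hxW)] at this
            exact (hmany hm).1.imp (fun h => (Nat.succ_le_succ h).trans this)
              fun h => (Nat.le_succ_of_le h).trans this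
    · rw [show growStep.run τ = τ₁ from if_neg hsmall, column_congr (σ := τ) (by rw [hmem₁])]
      refine ⟨hrem, fun hm => ⟨Or.inr ?_, (hmany hm).2⟩⟩
      rw [hτ₁r.reg2, hcount] at hsmall
      exact Nat.le_of_sub_eq_zero (not_not.1 hsmall)
  rw [h.reg0] at key
  refine ⟨key.1, fun hm => ⟨(key.2 hm).1.elim (fun hle => ?_) id, (key.2 hm).2⟩⟩
  -- This is used only to know `k₂ ≤ n`, so that `n` rounds of growth are enough.
  obtain ⟨W, -, -, hW⟩ := exists_large_removable hm
  have := Set.ncard_le_ncard (Set.subset_univ W)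
  rw [Set.ncard_univ, Nat.card_fin] at this
  omega

/-- Let the set in array `5` grow by an out-neighbour outside the set in array `2`. -/
def reachStep : LoopProgram :=
  .seq (find 5 2) (.ite (.var 12) (.put 5 (.var 13) (.const 0) (.const 1)) .skip)

/-- Let the set in array `5` grow by out-neighbours outside the set in array `2`. -/
def reach : LoopProgram := .forLoop 25 reachStep

/-- Until it is closed, the set has at least one more vertex than the number of rounds. After `n`
rounds that would be `n + 1` vertices, so it is closed by then. -/
theorem run_reach {D : Digraph (Fin n)} {k₁ k₂ : ℕ} {s : Fin n} {σ : Store}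
    (h : Ready D k₁ k₂ s σ) (hs : column n 5 σ = {s}) :
    column n 5 (reach.run σ) = reachable D (column n 2 σ) s := by
  set W := column n 2 σ with hW
  let I : ℕ → Set (Fin n) → Prop := fun y R => s ∈ R ∧ R ⊆ reachable D W s ∧
    (y + 1 ≤ R.ncard ∨ ∀ u v, ¬ Addable D R W u v)
  have key : I (σ.reg 0) (column n 5 (reach.run σ)) := by
    refine run_forLoop (fun i τ => I i (column n 5 τ)) ?_ ?_
    · change I 0 (column n 5 σ)
      rw [hs]
      refine ⟨rfl, ?_, Or.inl (by simp)⟩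
      rintro v rfl
      exact Relation.ReflTransGen.refl
    intro i hi τ hag _ hI
    change I (i + 1) (column n 5 (reachStep.run τ))
    have hτ := h.of_agree hag (by decide) (by decide)
    have hτW : column n 2 τ = W := column_congr (hag.2 2 (by decide))
    set R := column n 5 τ with hR
    set τ₁ := (find 5 2).run τ with hτ₁
    have hR₁ : column n 5 τ₁ = R := column_congr (by rw [hτ₁, run_find_mem])
    obtain ⟨hf1, hf2⟩ := run_find (a := 5) (b := 2) hτ.reg0 hτ.adj
    rw [hτW, ← hτ₁] at hf1 hf2
    obtain ⟨hsR, hsub, hy⟩ := hI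
    by_cases hfound : τ₁.reg 12 ≠ 0
    · obtain ⟨u, v, ⟨hu, huv, hv, hvW⟩, h13⟩ := hf1 hfound
      rw [show reachStep.run τ = τ₁.setMem 5 (τ₁.reg 13) 0 1 from if_pos hfound, h13,
        column_setMem_one, hR₁]
      refine ⟨Or.inr hsR, Set.insert_subset ((hsub hu).tail ⟨huv, hvW⟩) hsub, Or.inl ?_⟩
      rw [Set.ncard_insert_of_notMem hv]
      rcases hy with hy | hy
      · exact Nat.succ_le_succ hy
      · exact (hy u v ⟨hu, huv, hv, hvW⟩).elim
    · rw [show reachStep.run τ = τ₁ from if_neg hfound, hR₁]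
      exact ⟨hsR, hsub, Or.inr (hf2 (not_not.1 hfound))⟩
  rw [h.reg0] at key
  obtain ⟨hsR, hsub, hy⟩ := key
  refine hsub.antisymm fun v hv => ?_
  replace hy := hy.resolve_left fun hle => by
    have := Set.ncard_le_ncard (Set.subset_univ (column n 5 (reach.run σ)))
    rw [Set.ncard_univ, Nat.card_fin] at this
    omega
  replace hv : Relation.ReflTransGen (fun u v => D.Adj u v ∧ v ∉ W) s v := hv
  induction hv with
  | refl => exact hsR
  | tail _ huv ih =>
    by_contra hnot
    exact hy _ _ ⟨ih, huv.1, hnot, huv.2⟩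

/-- Compute in array `5` the first part of a partition whose out-branching has the root in
register `3`. -/
def partitionFrom : LoopProgram :=
  .seq computeBound (.seq (clear 2) (.seq (singleton 6) (.seq grow (.seq (singleton 5) reach))))

theorem run_partitionFrom {D : Digraph (Fin n)} {k₁ k₂ : ℕ} {s : Fin n} {σ : Store}
    (h : Env D k₁ k₂ s σ) : ∃ W, Removable D s W ∧
      (ManyBranchableOutNeighbors D k₁ k₂ s → k₂ ≤ W.ncard ∧ IsLight D k₁ k₂ s W) ∧
      column n 5 (partitionFrom.run σ) = reachable D W s := by
  have h₁ := run_computeBound h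
  have h₂ := h₁.run (clear 2) (by decide) (by decide)
  have h₃ := h₂.run (singleton 6) (by decide) (by decide)
  have h₄ := h₃.run grow (by decide) (by decide)
  have h₅ := h₄.run (singleton 5) (by decide) (by decide)
  obtain ⟨hrem, hmany⟩ := run_grow h₃
    (by rw [column_congr (run_mem (by decide) _), run_clear h₁.reg0])
    (run_singleton (by decide) h₂)
  refine ⟨_, hrem, hmany, ?_⟩
  have := run_reach h₅ (run_singleton (by decide) h₄)
  rwa [column_congr (a := 2) (run_mem (by decide) _)] at this

/-- Copy array `5` to array `1`. -/
def output : LoopProgram :=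
  .forLoop 27 (.ite (.get 5 (.var 27) (.const 0))
    (.put 1 (.var 27) (.const 0) (.const 1)) (.put 1 (.var 27) (.const 0) (.const 0)))

theorem run_output {σ : Store} (h : σ.reg 0 = n) :
    column n 1 (output.run σ) = column n 5 σ := by
  refine run_forLoop_column _ h ?_
  intro v τ hag hx _
  have h2 : v ∈ column n 5 σ ↔ τ.mem 5 v 0 ≠ 0 := by rw [hag.2 5 (by decide)]; rfl
  rw [h2]
  simp only [run, Expr.eval, hx]
  split_ifs with h3
  · exact ⟨by simp [Store.setMem_mem, h3], fun i hi => by simp [Store.setMem_mem, hi]⟩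
  · exact ⟨by simp [Store.setMem_mem, h3], fun i hi => by simp [Store.setMem_mem, hi]⟩

theorem wellFormed_partitionFrom : partitionFrom.WellFormed := by
  simp +decide [partitionFrom, computeBound, clear, singleton, grow, growStep, reach, reachStep,
    count, find, findFrom, addLightSet, fillFree, shrink, testLight, distances, initDistances,
    initRow, relaxDistances, relaxRow, relaxVia, addSet, WellFormed]

/-- The algorithm for a given root. -/
def solveWithRoot : LoopProgram := .seq partitionFrom output

theorem run_solveWithRoot {D : Digraph (Fin n)} {k₁ k₂ : ℕ} {s : Fin n} {σ : Store}
    (h : Env D k₁ k₂ s σ) (hD : MinInDegreeGeOne D Set.univ)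
    (hs : ManyBranchableOutNeighbors D k₁ k₂ s) :
    IsGoodPartitionWithRoot D k₁ k₂ s (outputSet n (solveWithRoot.run σ))
      (outputSet n (solveWithRoot.run σ))ᶜ := by
  obtain ⟨W, hrem, hmany, hR⟩ := run_partitionFrom h
  have h₁ : Env D k₁ k₂ s (partitionFrom.run σ) :=
    h.of_agree (agree_run _ σ) (by decide) (by decide)
  have hout : outputSet n (solveWithRoot.run σ) = reachable D W s :=
    (run_output h₁.reg0).trans hR
  rw [hout]
  obtain ⟨h2, h3⟩ := le_ncard_reachable hs hrem.1 (hmany hs).2 (hmany hs).1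
  exact isGoodPartitionWithRoot_reachable hD hrem.1 hrem.2 h2 h3

/-- Copy the set in array `5` if it is the first part of a good partition, judging from its size in
register `30` and the size of its complement in register `31`. -/
def outputIfLarge : LoopProgram :=
  .ite (.sub (.var 1) (.var 30)) .skip (.ite (.sub (.var 2) (.var 31)) .skip output)

theorem run_outputIfLarge {k₁ k₂ : ℕ} {τ : Store} (h₁ : τ.reg 1 = k₁) (h₂ : τ.reg 2 = k₂) :
    (k₁ ≤ τ.reg 30 ∧ k₂ ≤ τ.reg 31 ∧ outputIfLarge.run τ = output.run τ) ∨
    (¬ (k₁ ≤ τ.reg 30 ∧ k₂ ≤ τ.reg 31) ∧ outputIfLarge.run τ = τ) := by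
  have hrun : outputIfLarge.run τ =
      if τ.reg 1 - τ.reg 30 ≠ 0 then τ else if τ.reg 2 - τ.reg 31 ≠ 0 then τ else output.run τ := rfl
  rw [hrun, h₁, h₂]
  by_cases h3 : k₁ - τ.reg 30 ≠ 0
  · exact Or.inr ⟨by omega, if_pos h3⟩
  · rw [if_neg h3]
    by_cases h4 : k₂ - τ.reg 31 ≠ 0
    · exact Or.inr ⟨by omega, if_pos h4⟩
    · exact Or.inl ⟨by omega, by omega, if_neg h4⟩

/-- Compute the sizes of the set in array `5` and of its complement. -/
def computeSizes : LoopProgram :=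
  .seq (count 24 30 (.get 5 (.var 24) (.const 0)))
    (count 24 31 (.sub (.const 1) (.get 5 (.var 24) (.const 0))))

theorem run_computeSizes {τ : Store} (h : τ.reg 0 = n) :
    (computeSizes.run τ).reg 30 = (column n 5 τ).ncard ∧
      (computeSizes.run τ).reg 31 = (column n 5 τ)ᶜ.ncard := by
  constructor
  · refine (run_count_reg _ _ _ _ (by decide) (by decide)).trans ?_
    exact run_count_column h (by decide) (by decide)
  · refine run_count _ ((run_count_reg _ _ _ _ (by decide) (by decide)).trans h)
      (by decide) (by decide) fun ρ hρ hmem v hv => ?_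
    simp only [Expr.eval, hmem, hv, run_count_mem, column, Set.mem_compl_iff, Set.mem_ofPred_eq]
    omega

/-- Run the algorithm for the root in register `3`, and copy the result if it is good. -/
def tryRoot : LoopProgram := .seq partitionFrom (.seq computeSizes outputIfLarge)

/-- The size check replaces any test of the degree condition: passing it certifies a good partition,
and a root of large branchable out-degree always passes. -/
theorem run_tryRoot {D : Digraph (Fin n)} {k₁ k₂ : ℕ} {s : Fin n} {σ : Store}
    (h : Env D k₁ k₂ s σ) (hD : MinInDegreeGeOne D Set.univ) :
    IsGoodPartitionWithRoot D k₁ k₂ s (outputSet n (tryRoot.run σ))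
      (outputSet n (tryRoot.run σ))ᶜ ∨
    (¬ ManyBranchableOutNeighbors D k₁ k₂ s ∧
      outputSet n (tryRoot.run σ) = outputSet n σ) := by
  obtain ⟨W, hrem, hmany, hR⟩ := run_partitionFrom h
  have h₁ : Env D k₁ k₂ s (partitionFrom.run σ) :=
    h.of_agree (agree_run _ σ) (by decide) (by decide)
  have hout : column n 1 (partitionFrom.run σ) = outputSet n σ :=
    column_congr (run_mem (by decide) _)
  have hrun : tryRoot.run σ = outputIfLarge.run (computeSizes.run (partitionFrom.run σ)) := by
    rw [tryRoot, LoopProgram.run, LoopProgram.run]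
  rw [hrun]
  clear hrun
  generalize partitionFrom.run σ = τ at *
  have h₂ : Env D k₁ k₂ s (computeSizes.run τ) := h₁.of_agree (agree_run _ _) (by decide) (by decide)
  have hm : (computeSizes.run τ).mem = τ.mem :=
    (run_count_mem _ _ _ _).trans (run_count_mem _ _ _ _)
  obtain ⟨hc₁, hc₂⟩ := run_computeSizes h₁.reg0
  generalize computeSizes.run τ = ρ at *
  rw [hR] at hc₁ hc₂
  rcases run_outputIfLarge h₂.reg1 h₂.reg2 with ⟨hk₁, hk₂, hrun⟩ | ⟨hk, hrun⟩
  · left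
    rw [hc₁] at hk₁
    rw [hc₂] at hk₂
    have hres : outputSet n (output.run ρ) = reachable D W s := by
      rw [← hR]
      exact (run_output h₂.reg0).trans (column_congr (by rw [hm]))
    rw [hrun, hres]
    exact isGoodPartitionWithRoot_reachable hD hrem.1 hrem.2 hk₁ hk₂
  · right
    rw [hc₁, hc₂] at hk
    refine ⟨fun hm => hk (le_ncard_reachable hm hrem.1 (hmany hm).2 (hmany hm).1), ?_⟩
    rw [hrun, ← hout]
    exact column_congr (by rw [hm])

/-- The algorithm that tries all roots. -/
def solve : LoopProgram := .forLoop 3 tryRoot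

theorem wellFormed_output : output.WellFormed := by
  simp +decide [output, WellFormed]

theorem wellFormed_solveWithRoot : solveWithRoot.WellFormed :=
  ⟨wellFormed_partitionFrom, wellFormed_output⟩

theorem wellFormed_solve : solve.WellFormed :=
  ⟨by decide, by decide, wellFormed_partitionFrom,
    by simp +decide [computeSizes, count, WellFormed], trivial, trivial, wellFormed_output⟩

/-- The input matrix has entries `0` and `1`, so its row `s` already lists the vertex weights. -/
theorem weight_eq (D : Digraph (Fin n)) (s v : Fin n) :
    weight D s v = open Classical in if D.Adj s v then 1 else 0 := by
  unfold weight
  split_ifs with h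
  · rw [Set.inter_eq_left.2 (by simpa [outNeighbors] using h), Set.ncard_singleton]
  · rw [Set.singleton_inter_eq_empty.2 (show v ∉ outNeighbors D s from h), Set.ncard_empty]

theorem env_inputWithVertex (D : Digraph (Fin n)) (k₁ k₂ : ℕ) (s : Fin n) :
    Env D k₁ k₂ s (inputWithVertex D k₁ k₂ s) := by
  have hadj : ∀ u v : Fin n, (inputWithVertex D k₁ k₂ s).mem 0 u v =
      open Classical in if D.Adj u v then 1 else 0 := by
    intro u v
    by_cases h : D.Adj u v
    · rw [if_pos h]
      exact if_pos ⟨rfl, u, v, rfl, rfl, h⟩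
    · rw [if_neg h]
      refine if_neg ?_
      rintro ⟨-, u', v', hu, hv, h'⟩
      rw [Fin.ext hu, Fin.ext hv] at h'
      exact h h'
  exact ⟨rfl, rfl, rfl, rfl, fun u v => by simp [hadj], fun v => by rw [hadj, weight_eq]⟩

/-- Once a suitable root has been tried, the output stays good: later roots either leave it
unchanged or overwrite it with another good partition, possibly with a different root. -/
theorem run_solve {D : Digraph (Fin n)} {k₁ k₂ : ℕ} (hD : MinInDegreeGeOne D Set.univ)
    (hs : ∃ s, ManyBranchableOutNeighbors D k₁ k₂ s) :
    ∃ s, IsGoodPartitionWithRoot D k₁ k₂ s (outputSet n (solve.run (input D k₁ k₂)))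
      (outputSet n (solve.run (input D k₁ k₂)))ᶜ := by
  have key := run_forLoop (x := 3) (P := tryRoot) (σ := input D k₁ k₂) (fun i τ =>
    (∃ s : Fin n, (s : ℕ) < i ∧ ManyBranchableOutNeighbors D k₁ k₂ s) →
    ∃ s, IsGoodPartitionWithRoot D k₁ k₂ s (outputSet n τ) (outputSet n τ)ᶜ)
    (fun ⟨s, hs, _⟩ => (Nat.not_lt_zero _ hs).elim) (by
      intro i hi τ hag hx hI ⟨s, hsi, hs⟩
      have hτ : Env D k₁ k₂ ⟨i, hi⟩ τ := by
        have h := env_inputWithVertex D k₁ k₂ ⟨i, hi⟩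
        have h0 : τ.mem 0 = (input D k₁ k₂).mem 0 := hag.2 0 (by decide)
        refine ⟨?_, ?_, ?_, hx, ?_, ?_⟩
        · rw [hag.1 0 (by decide)]; rfl
        · rw [hag.1 1 (by decide)]; rfl
        · rw [hag.1 2 (by decide)]; rfl
        · rw [h0]; exact h.adj
        · rw [h0]; exact h.adj_row
      have hset : ∀ ρ c, outputSet n (ρ.setReg 3 c) = outputSet n ρ := fun _ _ => rfl
      rw [hset]
      rcases run_tryRoot hτ hD with h | ⟨h1, h2⟩
      · exact ⟨_, h⟩
      · rw [h2]
        refine hI ⟨s, ?_, hs⟩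
        have : (s : ℕ) ≠ i := by
          rintro he
          rw [show s = ⟨i, hi⟩ from Fin.ext he] at hs
          exact h1 hs
        omega)
  obtain ⟨s, hs⟩ := hs
  exact key ⟨s, s.2, hs⟩

end Main

end TwoPartition

/-- Part 1: the good 2-partition with root `s` exists. Part 2: there is a polynomial time algorithm
that finds a good 2-partition from `(D, k₁, k₂)`. Part 3: there is a polynomial time algorithm that
finds a good 2-partition with root `s` from `(D, k₁, k₂, s)`, for every suitable `s`. The running
times are bounded by a polynomial in the number `n` of vertices alone, and a partition is output
through its first part. -/
theorem corollary6 :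
    (∀ {V : Type*} [Finite V] (D : Digraph V) (k₁ k₂ : ℕ) (s : V),
      TwoPartition.Loopless D → TwoPartition.MinInDegreeGeOne D Set.univ →
      TwoPartition.ManyBranchableOutNeighbors D k₁ k₂ s →
      ∃ V₁ V₂ : Set V, TwoPartition.IsGoodPartitionWithRoot D k₁ k₂ s V₁ V₂) ∧
    (∃ (P : TwoPartition.Program) (p : Polynomial ℕ),
      ∀ (n : ℕ) (D : Digraph (Fin n)) (k₁ k₂ : ℕ),
        TwoPartition.Loopless D → TwoPartition.MinInDegreeGeOne D Set.univ →
        (∃ s, TwoPartition.ManyBranchableOutNeighbors D k₁ k₂ s) →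
        ∃ (t : ℕ) (τ : TwoPartition.Store),
          TwoPartition.Exec P (TwoPartition.input D k₁ k₂) t τ ∧ t ≤ p.eval n ∧
          ∃ s, TwoPartition.IsGoodPartitionWithRoot D k₁ k₂ s
            (TwoPartition.outputSet n τ) (TwoPartition.outputSet n τ)ᶜ) ∧
    (∃ (P : TwoPartition.Program) (p : Polynomial ℕ),
      ∀ (n : ℕ) (D : Digraph (Fin n)) (k₁ k₂ : ℕ) (s : Fin n),
        TwoPartition.Loopless D → TwoPartition.MinInDegreeGeOne D Set.univ →
        TwoPartition.ManyBranchableOutNeighbors D k₁ k₂ s →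
        ∃ (t : ℕ) (τ : TwoPartition.Store),
          TwoPartition.Exec P (TwoPartition.inputWithVertex D k₁ k₂ s) t τ ∧ t ≤ p.eval n ∧
          TwoPartition.IsGoodPartitionWithRoot D k₁ k₂ s
            (TwoPartition.outputSet n τ) (TwoPartition.outputSet n τ)ᶜ) := by
  refine ⟨?_, ?_, ?_⟩
  · intro V _ D k₁ k₂ s _ hD hs
    obtain ⟨W, hrem, hlight, hW⟩ := TwoPartition.exists_large_removable hs
    obtain ⟨h1, h2⟩ := TwoPartition.le_ncard_reachable hs hrem.1 hlight hW
    exact ⟨_, _, TwoPartition.isGoodPartitionWithRoot_reachable hD hrem.1 hrem.2 h1 h2⟩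
  · refine ⟨TwoPartition.solve.compile, TwoPartition.solve.time, fun n D k₁ k₂ _ hD hs => ?_⟩
    obtain ⟨t, ht, htn⟩ := TwoPartition.LoopProgram.exec_compile
      TwoPartition.wellFormed_solve (TwoPartition.input D k₁ k₂)
    exact ⟨t, _, ht, htn, TwoPartition.run_solve hD hs⟩
  · refine ⟨TwoPartition.solveWithRoot.compile, TwoPartition.solveWithRoot.time,
      fun n D k₁ k₂ s _ hD hs => ?_⟩
    obtain ⟨t, ht, htn⟩ := TwoPartition.LoopProgram.exec_compile
      TwoPartition.wellFormed_solveWithRoot (TwoPartition.inputWithVertex D k₁ k₂ s)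
    exact ⟨t, _, ht, htn,
      TwoPartition.run_solveWithRoot (TwoPartition.env_inputWithVertex D k₁ k₂ s) hD hs⟩
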